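/- Let $m,n$ be non-negative integers, let $\alpha_1,\dots,\alpha_n$ be linear forms on $\mathbb R^m$, let $\lambda>0$, and let $\chi:\mathbb R^m\to U(1)$ be a (continuous) unitary character, with differential $d\chi:\mathbb R^m\to i\mathbb R$ at $0$. For $z,w\in\mathbb C^n$ write $zw=\sum_k z_kw_k$, $|z|^2=z\bar z$, and $\omega((z,w),(z',w'))=\tfrac i2(zw'-z'w)$. For $t\in\mathbb R^m$ let $t\cdot z=(e^{i\alpha_1(t)}z_1,\dots,e^{i\alpha_n(t)}z_n)$. The generalized diamond group is $G=\mathbb R^m\times\mathbb C^n\times\mathbb R$ with $$(t,z,c)(t',z',c')=\bigl(t+t',\,z+t\cdot z',\,c+c'+\tfrac12\omega((z,\bar z),(t\cdot z',\overline{t\cdot z'}))\bigr);$$ it acts on $\mathbb C^n$ by $(t,z_0,c_0)\cdot z=t\cdot z+z_0$. Its Lie algebra is $\mathfrak g=\mathbb R^m\times\mathbb C^n\times\mathbb R$, and for $s\in(\mathbb R^m)^*$, $v\in\mathbb C^n$, $d\in\mathbb R$ the element $(s,v,d)\in\mathfrak g^*$ is given by $\langle(s,v,d),(t,u,c)\rangle=\langle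 s,t\rangle+\omega((v,\bar v),(u,\bar u))+cd$. Let $\mathrm{Ad}$ be the adjoint action and $\mathrm{Ad}^*$ the coadjoint action, $\langle\mathrm{Ad}^*(g)\xi,X\rangle=\langle\xi,\mathrm{Ad}(g^{-1})X\rangle$. Let $d\mu_\lambda(z)=(2\pi)^{-n}\lambda^n\,dm(z)$, $m$ being the Lebesgue measure on $\mathbb C^n$, and let $\mathcal F_\lambda$ be the Fock space of all holomorphic functions $f$ on $\mathbb C^n$ with $\int|f|^2e^{-\lambda|z|^2/2}\,d\mu_\lambda<\infty$, with coherent states $e_z(w)=e^{\lambda\bar zw/2}$. Let $\pi$ be the representation of $G$ on $\mathcal F_\lambda$ defined by $$(\pi(t,z_0,c_0)f)(z)=\chi(t)\exp\bigl(i\lambda c_0+\tfrac\lambda2\bar z_0z-\tfrac\lambda4|z_0|^2\bigr)f((-t)\cdot(z-z_0)),$$ and let $d\pi(X)f=\frac{d}{ds}\big|_{s=0}\pi(\exp(sX))f$ (derivative in the norm of $\mathcal F_\lambda$, on the domain of all $f$ for which it exists). For an operator $A$ on $\mathcal F_\lambda$ whose domain contains the coherent states, let $k_A(z,w)=\langle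 Ae_w,e_z\rangle$ and let $$W_0(A)(z)=2^n\int_{\mathbb C^n}k_A(z+w,z-w)\exp\bigl(\tfrac\lambda2(-z\bar z-w\bar w+z\bar w-\bar zw)\bigr)\,d\mu_\lambda(w)$$ be its complex Weyl symbol, whenever the integral converges. Then, for each $X\in\mathfrak g$, the coherent states belong to the domain of $d\pi(X)$ and the integral defining $W_0(d\pi(X))(z)$ converges for each $z\in\mathbb C^n$. Moreover: 1. There is a map $\psi:\mathbb C^n\to\mathfrak g^*$ such that $W_0(d\pi(X))(z)=i\langle\psi(z),X\rangle$ for all $X\in\mathfrak g$ and $z\in\mathbb C^n$, and it satisfies $\psi(g\cdot z)=\mathrm{Ad}^*(g)\,\psi(z)$ for all $g\in G$ and $z\in\mathbb C^n$. 2. For each $z\in\mathbb C^n$, $\psi(z)=\bigl(-i\,d\chi+\tfrac12\sum_{k=1}^n(1-\lambda|z_k|^2)\alpha_k,\,-\lambda z,\,\lambda\bigr)$. 3. $\psi$ is a bijection from $\mathbb C^n$ onto the orbit of $\xi_0=\bigl(-i\,d\chi+\tfrac12\sum_{k=1}^n\alpha_k,\,0,\,\lambda\bigr)\in\mathfrak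 g^*$ under the coadjoint action of $G$. -/

import Mathlib

open MeasureTheory

noncomputable section

namespace Diamond

/-! ### The generalized diamond group -/

/-- `ω((z,w),(z',w')) = (i/2)(z w' - z' w)`, where `z w = ∑ k, z k * w k`. -/
def omega {n : ℕ} (z w z' w' : Fin n → ℂ) : ℂ :=
  Complex.I / 2 * (z ⬝ᵥ w' - z' ⬝ᵥ w)

/-- The real number `ω((z,z̄),(z',z̄'))`; it is real by `omega_star_eq`. -/
def omegaR {n : ℕ} (z z' : Fin n → ℂ) : ℝ :=
  (omega z (star z) z' (star z')).re

theorem omegaR_eq_sum {n : ℕ} (z z' : Fin n → ℂ) :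
    omegaR z z' = ∑ k, ((z k).re * (z' k).im - (z k).im * (z' k).re) := by
  simp only [omegaR, omega, dotProduct, ← Finset.sum_sub_distrib, Finset.mul_sum, Complex.re_sum]
  refine Finset.sum_congr rfl fun k _ => ?_
  simp [Complex.mul_re, Complex.mul_im]
  ring

theorem omega_star_eq {n : ℕ} (z z' : Fin n → ℂ) :
    omega z (star z) z' (star z') = (omegaR z z' : ℂ) := by
  refine Complex.ext rfl ?_
  simp only [omega, dotProduct, ← Finset.sum_sub_distrib, Finset.mul_sum, Complex.im_sum,
    Complex.ofReal_im]
  refine Finset.sum_eq_zero fun k _ => ?_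
  simp [Complex.mul_re, Complex.mul_im]
  ring

/-- `|z|² = ∑ k, |z k|²`. -/
def absSq {n : ℕ} (z : Fin n → ℂ) : ℝ := ∑ k, ‖z k‖ ^ 2

/-- The action `t · z = (e^{iα₁(t)} z₁, …, e^{iαₙ(t)} zₙ)` of `ℝᵐ` on `ℂⁿ`. -/
def rot {m n : ℕ} (α : Fin n → Module.Dual ℝ (Fin m → ℝ)) (t : Fin m → ℝ) (z : Fin n → ℂ) :
    Fin n → ℂ :=
  fun k => Complex.exp (Complex.I * (α k t : ℂ)) * z k

/-- The generalized diamond group `G = ℝᵐ ⋊ Hₙ`, in its global coordinates `(t, z, c)`. -/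
@[ext]
structure Grp {m n : ℕ} (α : Fin n → Module.Dual ℝ (Fin m → ℝ)) where
  t : Fin m → ℝ
  z : Fin n → ℂ
  c : ℝ

/-- The Lie algebra `𝔤` of `G`: the tangent space at the identity, in the coordinates
`(t, u, c)`. -/
abbrev LieAlg (m n : ℕ) : Type := (Fin m → ℝ) × (Fin n → ℂ) × ℝ

section group
variable {m n : ℕ} {α : Fin n → Module.Dual ℝ (Fin m → ℝ)}

theorem rot_zero (z : Fin n → ℂ) : rot α 0 z = z := by
  funext k; simp [rot]

theorem rot_add (t t' : Fin m → ℝ) (z : Fin n → ℂ) : rot α (t + t') z = rot α t (rot α t' z) := by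
  funext k; simp [rot, mul_add, Complex.exp_add, mul_assoc]

theorem rot_vadd (t : Fin m → ℝ) (z z' : Fin n → ℂ) :
    rot α t (z + z') = rot α t z + rot α t z' := by
  funext k; simp [rot, mul_add]

theorem rot_neg (t : Fin m → ℝ) (z : Fin n → ℂ) : rot α t (-z) = -rot α t z := by
  funext k; simp [rot]

theorem omegaR_rot (t : Fin m → ℝ) (z z' : Fin n → ℂ) :
    omegaR (rot α t z) (rot α t z') = omegaR z z' := by
  simp only [omegaR_eq_sum]
  refine Finset.sum_congr rfl fun k _ => ?_
  have h := Real.sin_sq_add_cos_sq (α k t)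
  have e : Complex.exp (Complex.I * (α k t : ℂ))
      = ⟨Real.cos (α k t), Real.sin (α k t)⟩ := by
    rw [mul_comm, Complex.exp_mul_I]
    apply Complex.ext <;> simp [Complex.cos_ofReal_re, Complex.sin_ofReal_re]
  simp only [rot, e, Complex.mul_re, Complex.mul_im]
  linear_combination ((z k).re * (z' k).im - (z k).im * (z' k).re) * h

theorem omegaR_add_left (a b d : Fin n → ℂ) : omegaR (a + b) d = omegaR a d + omegaR b d := by
  simp only [omegaR_eq_sum, ← Finset.sum_add_distrib]
  exact Finset.sum_congr rfl fun k _ => by simp; ring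

theorem omegaR_add_right (a b d : Fin n → ℂ) : omegaR a (b + d) = omegaR a b + omegaR a d := by
  simp only [omegaR_eq_sum, ← Finset.sum_add_distrib]
  exact Finset.sum_congr rfl fun k _ => by simp; ring

theorem omegaR_smul_right (r : ℝ) (a b : Fin n → ℂ) : omegaR a (r • b) = r * omegaR a b := by
  simp only [omegaR_eq_sum, Finset.mul_sum]
  exact Finset.sum_congr rfl fun k _ => by simp; ring

theorem omegaR_self (a : Fin n → ℂ) : omegaR a a = 0 := by
  simp only [omegaR_eq_sum]
  exact Finset.sum_eq_zero fun k _ => by ring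

theorem omegaR_neg_left (a b : Fin n → ℂ) : omegaR (-a) b = -omegaR a b := by
  simp only [omegaR_eq_sum, ← Finset.sum_neg_distrib]
  exact Finset.sum_congr rfl fun k _ => by simp; ring

instance : Mul (Grp α) :=
  ⟨fun g h => ⟨g.t + h.t, g.z + rot α g.t h.z, g.c + h.c + 1 / 2 * omegaR g.z (rot α g.t h.z)⟩⟩

instance : One (Grp α) := ⟨⟨0, 0, 0⟩⟩

instance : Inv (Grp α) := ⟨fun g => ⟨-g.t, -rot α (-g.t) g.z, -g.c⟩⟩

@[simp] theorem mul_t (g h : Grp α) : (g * h).t = g.t + h.t := rfl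
@[simp] theorem mul_z (g h : Grp α) : (g * h).z = g.z + rot α g.t h.z := rfl
@[simp] theorem mul_c (g h : Grp α) :
    (g * h).c = g.c + h.c + 1 / 2 * omegaR g.z (rot α g.t h.z) := rfl
@[simp] theorem one_t : (1 : Grp α).t = 0 := rfl
@[simp] theorem one_z : (1 : Grp α).z = 0 := rfl
@[simp] theorem one_c : (1 : Grp α).c = 0 := rfl
@[simp] theorem inv_t (g : Grp α) : (g⁻¹).t = -g.t := rfl
@[simp] theorem inv_z (g : Grp α) : (g⁻¹).z = -rot α (-g.t) g.z := rfl
@[simp] theorem inv_c (g : Grp α) : (g⁻¹).c = -g.c := rfl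

instance : Group (Grp α) :=
  Group.ofLeftAxioms
    (fun a b d => by
      ext1
      · simp [add_assoc]
      · simp [rot_add, rot_vadd, add_assoc]
      · simp only [mul_c, mul_z, mul_t, rot_add, rot_vadd, omegaR_add_left, omegaR_add_right,
          omegaR_rot]
        ring)
    (fun a => by
      ext1
      · simp
      · simp [rot_zero]
      · simp [rot_zero, omegaR_eq_sum])
    (fun a => by
      ext1
      · simp
      · simp
      · simp [omegaR_neg_left, omegaR_self])

/-- The action `(t, z₀, c₀) · z = t · z + z₀` of `G` on `ℂⁿ`. -/
instance : MulAction (Grp α) (Fin n → ℂ) where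
  smul g z := rot α g.t z + g.z
  one_smul z := by
    change rot α 0 z + 0 = z
    rw [rot_zero, add_zero]
  mul_smul g h z := by
    change rot α (g.t + h.t) z + (g.z + rot α g.t h.z) = rot α g.t (rot α h.t z + h.z) + g.z
    rw [rot_add, rot_vadd]; abel

theorem smul_def (g : Grp α) (z : Fin n → ℂ) : g • z = rot α g.t z + g.z := rfl

/-- The global chart of `G`. -/
def chart (g : Grp α) : LieAlg m n := (g.t, g.z, g.c)

/-- The inverse of the global chart of `G`; it maps `0` to the identity. -/
def ofChart (α : Fin n → Module.Dual ℝ (Fin m → ℝ)) (x : LieAlg m n) : Grp α :=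
  ⟨x.1, x.2.1, x.2.2⟩

/-- The adjoint action `Ad(g) : 𝔤 → 𝔤`, the differential at the identity of `h ↦ g h g⁻¹`. -/
def Ad (g : Grp α) : LieAlg m n →L[ℝ] LieAlg m n :=
  fderiv ℝ (fun x : LieAlg m n => chart (g * ofChart α x * g⁻¹)) 0

/-- The coadjoint action: `⟨Ad*(g) ξ, X⟩ = ⟨ξ, Ad(g⁻¹) X⟩`. -/
def coAd (g : Grp α) (ξ : Module.Dual ℝ (LieAlg m n)) : Module.Dual ℝ (LieAlg m n) :=
  ξ ∘ₗ (Ad g⁻¹ : LieAlg m n →ₗ[ℝ] LieAlg m n)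

/-- The orbit `𝒪(ξ)` of `ξ` under the coadjoint action of `G`. -/
def coadjointOrbit (α : Fin n → Module.Dual ℝ (Fin m → ℝ)) (ξ : Module.Dual ℝ (LieAlg m n)) :
    Set (Module.Dual ℝ (LieAlg m n)) :=
  Set.range fun g : Grp α => coAd g ξ

/-- The element `(s, v, d)` of `𝔤*`: `⟨(s,v,d),(t,u,c)⟩ = ⟨s,t⟩ + ω((v,v̄),(u,ū)) + c d`. -/
def dualElt (s : Module.Dual ℝ (Fin m → ℝ)) (v : Fin n → ℂ) (d : ℝ) :
    Module.Dual ℝ (LieAlg m n) where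
  toFun X := s X.1 + omegaR v X.2.1 + X.2.2 * d
  map_add' X Y := by simp [omegaR_add_right]; ring
  map_smul' r X := by simp [omegaR_smul_right]; ring

/-- The exponential map `𝔤 → G`. If `α k t = 0`, the `k`-th summand in the last coordinate is
`0 / 0 = 0`, the limit value. That this is the exponential map is `exp_add_smul` together with
`hasDerivAt_exp`. -/
def exp (α : Fin n → Module.Dual ℝ (Fin m → ℝ)) (X : LieAlg m n) : Grp α where
  t := X.1
  z := fun k =>
    (if α k X.1 = 0 then 1
      else (Complex.exp (Complex.I * (α k X.1 : ℂ)) - 1) / (Complex.I * (α k X.1 : ℂ))) * X.2.1 k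
  c := X.2.2 + 1 / 2 * ∑ k, ‖X.2.1 k‖ ^ 2 * ((α k X.1 - Real.sin (α k X.1)) / (α k X.1) ^ 2)

theorem exp_smul_z (s : ℝ) (X : LieAlg m n) (k : Fin n) :
    (exp α (s • X)).z k = (if α k X.1 = 0 then (s : ℂ) else
      ⟨Real.sin (s * α k X.1) / α k X.1, (1 - Real.cos (s * α k X.1)) / α k X.1⟩) * X.2.1 k := by
  rcases eq_or_ne (α k X.1) 0 with h | h
  · simp [exp, h]
  rcases eq_or_ne s 0 with rfl | hs
  · have : (⟨Real.sin (0 * α k X.1) / α k X.1, (1 - Real.cos (0 * α k X.1)) / α k X.1⟩ : ℂ) = 0 :=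
      Complex.ext (by simp) (by simp)
    rw [if_neg h, this]
    simp [exp]
  have hc : (α k X.1 : ℂ) ≠ 0 := by exact_mod_cast h
  have hsc : (s : ℂ) ≠ 0 := by exact_mod_cast hs
  have e : (⟨Real.sin (s * α k X.1) / α k X.1, (1 - Real.cos (s * α k X.1)) / α k X.1⟩ : ℂ)
      = (Complex.exp (Complex.I * ((s * α k X.1 : ℝ) : ℂ)) - 1) / (Complex.I * (α k X.1 : ℂ)) := by
    rw [mul_comm Complex.I ((s * α k X.1 : ℝ) : ℂ), Complex.exp_mul_I, ← Complex.ofReal_cos,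
      ← Complex.ofReal_sin, Complex.mk_eq_add_mul_I]
    push_cast
    field_simp
    linear_combination (1 - Complex.cos (s * α k X.1)) * Complex.I_sq
  simp only [exp, Prod.smul_fst, Prod.smul_snd, map_smul, smul_eq_mul, mul_eq_zero, hs, h, or_self,
    if_false, e, Pi.smul_apply, Complex.real_smul]
  push_cast
  field_simp

theorem exp_smul_c (s : ℝ) (X : LieAlg m n) :
    (exp α (s • X)).c = s * X.2.2 + 1 / 2 * ∑ k, ‖X.2.1 k‖ ^ 2 *
      ((s * α k X.1 - Real.sin (s * α k X.1)) / (α k X.1) ^ 2) := by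
  simp only [exp, Prod.smul_fst, Prod.smul_snd, map_smul, smul_eq_mul, Pi.smul_apply, norm_smul,
    Real.norm_eq_abs, mul_pow, sq_abs]
  congr 2
  refine Finset.sum_congr rfl fun k _ => ?_
  rcases eq_or_ne s 0 with rfl | hs
  · simp
  rcases eq_or_ne (α k X.1) 0 with h | h
  · simp [h]
  field_simp

/-- `s ↦ exp(sX)` is a one-parameter subgroup of `G`. -/
theorem exp_add_smul (s s' : ℝ) (X : LieAlg m n) :
    exp α ((s + s') • X) = exp α (s • X) * exp α (s' • X) := by
  have e : ∀ x : ℝ, Complex.exp (Complex.I * (x : ℂ)) = ⟨Real.cos x, Real.sin x⟩ := by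
    intro x
    rw [mul_comm, Complex.exp_mul_I]
    apply Complex.ext <;> simp [Complex.cos_ofReal_re, Complex.sin_ofReal_re]
  ext1
  · simp [exp, add_smul]
  · funext k
    simp only [mul_z, Pi.add_apply, rot, exp_smul_z]
    have ht : (exp α (s • X)).t = s • X.1 := rfl
    rcases eq_or_ne (α k X.1) 0 with h | h
    · simp [h, ht]; ring
    · simp only [h, if_false, ht, map_smul, smul_eq_mul, e]
      rw [← mul_assoc, ← add_mul]
      congr 1
      apply Complex.ext
      · simp only [Complex.add_re, Complex.mul_re, add_mul, Real.sin_add]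
        field_simp; ring
      · simp only [Complex.add_im, Complex.mul_im, add_mul, Real.cos_add]
        field_simp; ring
  · have ht : (exp α (s • X)).t = s • X.1 := rfl
    rw [mul_c, exp_smul_c, exp_smul_c, exp_smul_c, omegaR_eq_sum]
    rw [show ∀ a b c d f p q : ℝ, a = b + d → c = f + p + q →
      a + 1 / 2 * c = b + 1 / 2 * f + (d + 1 / 2 * p) + 1 / 2 * q by intros; linarith]
    · ring
    rw [← Finset.sum_add_distrib, ← Finset.sum_add_distrib]
    refine Finset.sum_congr rfl fun k _ => ?_
    simp only [rot, exp_smul_z, ht, map_smul, smul_eq_mul, e]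
    rw [← Complex.normSq_eq_norm_sq, Complex.normSq_apply]
    rcases eq_or_ne (α k X.1) 0 with h | h
    · simp [h]; ring
    · simp only [h, if_false, Complex.mul_re, Complex.mul_im, add_mul, Real.sin_add]
      have h1 := Real.sin_sq_add_cos_sq (s * α k X.1)
      generalize Real.sin (s * α k X.1) = S, Real.cos (s * α k X.1) = C,
        Real.sin (s' * α k X.1) = S', Real.cos (s' * α k X.1) = C' at *
      field_simp
      linear_combination (-((X.2.1 k).re ^ 2 + (X.2.1 k).im ^ 2) * S') * h1

/-- The one-parameter subgroup `s ↦ exp(sX)` has velocity `X` at the identity. -/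
theorem hasDerivAt_exp (X : LieAlg m n) :
    HasDerivAt (fun s : ℝ => chart (exp α (s • X))) X 0 := by
  have hid := hasDerivAt_id (0 : ℝ)
  refine HasDerivAt.prodMk (f₁ := fun s : ℝ => s • X.1) ?_ (HasDerivAt.prodMk ?_ ?_)
  · simpa using hid.smul_const X.1
  · refine hasDerivAt_pi.2 fun k => ?_
    change HasDerivAt (fun s : ℝ => (exp α (s • X)).z k) _ 0
    simp only [exp_smul_z]
    rcases eq_or_ne (α k X.1) 0 with h | h
    · simp only [h, if_true]
      simpa using (hid.ofReal_comp).mul_const (X.2.1 k)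
    · simp only [h, if_false, Complex.mk_eq_add_mul_I]
      have h1 : HasDerivAt (fun s : ℝ => Real.sin (s * α k X.1) / α k X.1) 1 0 := by
        have := (((hid.mul_const (α k X.1)).sin).div_const (α k X.1))
        simpa [h] using this
      have h2 : HasDerivAt (fun s : ℝ => (1 - Real.cos (s * α k X.1)) / α k X.1) 0 0 := by
        have := (((hid.mul_const (α k X.1)).cos).const_sub 1).div_const (α k X.1)
        simpa using this
      simpa using ((h1.ofReal_comp.add (h2.ofReal_comp.mul_const Complex.I)).mul_const (X.2.1 k))
  · change HasDerivAt (fun s : ℝ => (exp α (s • X)).c) _ 0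
    simp only [exp_smul_c]
    have h1 : ∀ k, HasDerivAt (fun s : ℝ => ‖X.2.1 k‖ ^ 2 *
      ((s * α k X.1 - Real.sin (s * α k X.1)) / (α k X.1) ^ 2)) 0 0 := fun k => by
      have := (((hid.mul_const (α k X.1)).sub (hid.mul_const (α k X.1)).sin).div_const
        ((α k X.1) ^ 2)).const_mul (‖X.2.1 k‖ ^ 2)
      simpa using this
    have h2 := (hid.mul_const X.2.2).fun_add
      ((HasDerivAt.fun_sum (u := Finset.univ) fun k _ => h1 k).const_mul (1 / 2 : ℝ))
    simpa using h2

end group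

/-! ### The Fock space -/

/-- `dμ_λ(z) = (2π)⁻ⁿ λⁿ dm(z)`, with `m` the Lebesgue measure of `ℂⁿ`. -/
def mu (n : ℕ) (lam : ℝ) : Measure (Fin n → ℂ) :=
  ENNReal.ofReal ((lam / (2 * Real.pi)) ^ n) • volume

/-- The measure `e^{-λ|z|²/2} dμ_λ(z)`. -/
def fockMeasure (n : ℕ) (lam : ℝ) : Measure (Fin n → ℂ) :=
  (mu n lam).withDensity fun z => ENNReal.ofReal (Real.exp (-lam * absSq z / 2))

/-- The holomorphic functions `f` on `ℂⁿ` with `∫ |f|² e^{-λ|z|²/2} dμ_λ < ∞`. -/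
def fockSubmodule (n : ℕ) (lam : ℝ) : Submodule ℂ ((Fin n → ℂ) → ℂ) where
  carrier := {f | Differentiable ℂ f ∧ MemLp f 2 (fockMeasure n lam)}
  add_mem' hf hg := ⟨hf.1.add hg.1, hf.2.add hg.2⟩
  zero_mem' := ⟨differentiable_const 0, MemLp.zero⟩
  smul_mem' c _ hf := ⟨hf.1.const_smul c, hf.2.const_smul c⟩

/-- The Fock space `ℱ_λ`. -/
def FockSpace (n : ℕ) (lam : ℝ) : Type := ↥(fockSubmodule n lam)

namespace FockSpace
variable {n : ℕ} {lam : ℝ}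

instance : AddCommGroup (FockSpace n lam) := inferInstanceAs (AddCommGroup ↥(fockSubmodule n lam))
instance : Module ℂ (FockSpace n lam) := inferInstanceAs (Module ℂ ↥(fockSubmodule n lam))

instance : CoeFun (FockSpace n lam) fun _ => (Fin n → ℂ) → ℂ := ⟨fun f => f.1⟩

theorem add_apply (f g : FockSpace n lam) (z : Fin n → ℂ) : (f + g) z = f z + g z := rfl
theorem smul_apply (a : ℂ) (f : FockSpace n lam) (z : Fin n → ℂ) : (a • f) z = a * f z := rfl

theorem ext {f g : FockSpace n lam} (h : ∀ z, f z = g z) : f = g := Subtype.ext (funext h)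

theorem differentiable (f : FockSpace n lam) : Differentiable ℂ (f : (Fin n → ℂ) → ℂ) := f.2.1

theorem memLp (f : FockSpace n lam) : MemLp (f : (Fin n → ℂ) → ℂ) 2 (fockMeasure n lam) := f.2.2

/-- The inner product, in Mathlib's convention conjugate-linear in the first variable. -/
instance : Inner ℂ (FockSpace n lam) :=
  ⟨fun f g => ∫ z, star (f z) * g z ∂fockMeasure n lam⟩

theorem inner_def (f g : FockSpace n lam) :
    inner ℂ f g = ∫ z, star (f z) * g z ∂fockMeasure n lam := rfl

theorem inner_eq_toLp (f g : FockSpace n lam) :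
    inner ℂ f g = inner ℂ (f.memLp.toLp _) (g.memLp.toLp _) := by
  rw [inner_def, L2.inner_def]
  refine integral_congr_ae ?_
  filter_upwards [f.memLp.coeFn_toLp, g.memLp.coeFn_toLp] with z hf hg
  rw [hf, hg, RCLike.inner_apply, mul_comm]
  rfl

theorem continuous_absSq : Continuous (absSq : (Fin n → ℂ) → ℝ) := by
  unfold absSq; fun_prop

theorem const_pos [h : Fact (0 < lam)] : 0 < (lam / (2 * Real.pi)) ^ n :=
  pow_pos (div_pos h.out Real.two_pi_pos) n

theorem volume_ac [h : Fact (0 < lam)] :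
    (volume : Measure (Fin n → ℂ)) ≪ fockMeasure n lam := by
  have h1 : (volume : Measure (Fin n → ℂ)) ≪ mu n lam :=
    Measure.absolutelyContinuous_smul (by simpa using const_pos)
  refine h1.trans (withDensity_absolutelyContinuous' ?_ ?_)
  · have := (continuous_absSq (n := n)).measurable
    fun_prop
  · exact Filter.Eventually.of_forall fun z => by simpa using Real.exp_pos _

instance instCore [Fact (0 < lam)] : InnerProductSpace.Core ℂ (FockSpace n lam) where
  conj_inner_symm f g := by rw [inner_eq_toLp, inner_eq_toLp, inner_conj_symm]
  re_inner_nonneg f := by rw [inner_eq_toLp]; exact inner_self_nonneg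
  add_left f g h := by
    simp only [inner_eq_toLp, ← inner_add_left]
    rfl
  smul_left f g a := by
    simp only [inner_eq_toLp, ← inner_smul_left]
    rfl
  definite f hf := by
    rw [inner_eq_toLp, inner_self_eq_zero, Lp.eq_zero_iff_ae_eq_zero] at hf
    have h1 : (f : (Fin n → ℂ) → ℂ) =ᵐ[volume] fun _ => 0 :=
      volume_ac.ae_le (f.memLp.coeFn_toLp.symm.trans hf)
    exact ext fun z => congrFun
      ((Continuous.ae_eq_iff_eq volume f.differentiable.continuous continuous_const).1 h1) z

instance [Fact (0 < lam)] : NormedAddCommGroup (FockSpace n lam) :=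
  (instCore (n := n) (lam := lam)).toNormedAddCommGroup

instance [Fact (0 < lam)] : InnerProductSpace ℂ (FockSpace n lam) :=
  InnerProductSpace.ofCore (instCore (n := n) (lam := lam)).toCore

theorem memLp_iff [h : Fact (0 < lam)] {f : (Fin n → ℂ) → ℂ} (hf : Continuous f) :
    MemLp f 2 (fockMeasure n lam) ↔
      Integrable fun z => Real.exp (-lam * absSq z / 2) * ‖f z‖ ^ 2 := by
  have hm : Measurable fun z : Fin n → ℂ => ENNReal.ofReal (Real.exp (-lam * absSq z / 2)) := by
    have := (continuous_absSq (n := n)).measurable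
    fun_prop
  rw [memLp_two_iff_integrable_sq_norm hf.aestronglyMeasurable, fockMeasure,
    integrable_withDensity_iff_integrable_smul' hm
      (Filter.Eventually.of_forall fun _ => ENNReal.ofReal_lt_top), mu,
    integrable_smul_measure (by simpa using const_pos) ENNReal.ofReal_ne_top]
  simp only [ENNReal.toReal_ofReal (Real.exp_pos _).le, smul_eq_mul]

/-- The coherent state `e_z(w) = exp(λ z̄ w / 2)`. -/
def coherentFun (lam : ℝ) (z w : Fin n → ℂ) : ℂ :=
  Complex.exp ((lam : ℂ) * (star z ⬝ᵥ w) / 2)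

theorem coherentFun_mem [h : Fact (0 < lam)] (z : Fin n → ℂ) :
    coherentFun lam z ∈ fockSubmodule n lam := by
  have hd : Differentiable ℂ (coherentFun lam z) := by
    unfold coherentFun dotProduct
    fun_prop
  refine ⟨hd, (memLp_iff hd.continuous).2 ?_⟩
  have h1 : ∀ k : Fin n, Integrable fun v : ℂ =>
      Complex.exp (-((lam / 2 : ℝ) : ℂ) * (‖v‖ : ℂ) ^ 2 + (lam : ℂ) * (inner ℝ (z k) v : ℝ)) :=
    fun k => GaussianFourier.integrable_cexp_neg_mul_sq_norm_add
      (by simpa using h.out) (lam : ℂ) (z k)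
  have h2 := (Integrable.fintype_prod (μ := fun _ : Fin n => (volume : Measure ℂ)) h1).norm
  refine h2.congr (Filter.Eventually.of_forall fun w => ?_)
  simp only [norm_prod, Complex.norm_exp, coherentFun, ← Real.exp_sum, ← Real.exp_nat_mul,
    ← Real.exp_add]
  congr 1
  simp only [absSq, dotProduct, Finset.mul_sum, Finset.sum_div, Complex.re_sum,
    ← Finset.sum_add_distrib]
  refine Finset.sum_congr rfl fun k _ => ?_
  have : (((‖w k‖ : ℝ) : ℂ) ^ 2).re = ‖w k‖ ^ 2 := by rw [← Complex.ofReal_pow, Complex.ofReal_re]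
  simp [Complex.inner, ← Complex.ofReal_pow]
  ring

/-- The coherent state `e_z` as an element of the Fock space. -/
def coherent (n : ℕ) (lam : ℝ) [Fact (0 < lam)] (z : Fin n → ℂ) : FockSpace n lam :=
  ⟨coherentFun lam z, coherentFun_mem z⟩

end FockSpace

/-! ### The representation `π` and its differential -/

section representation
variable {m n : ℕ} {α : Fin n → Module.Dual ℝ (Fin m → ℝ)}

/-- `χ(t) exp(iλc₀ + (λ/2) z̄₀ z - (λ/4)|z₀|²) f(t⁻¹ · (z - z₀))`. -/
def piFun (lam : ℝ) (χ : AddChar (Fin m → ℝ) Circle) (g : Grp α) (f : (Fin n → ℂ) → ℂ)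
    (z : Fin n → ℂ) : ℂ :=
  (χ g.t : ℂ) *
    Complex.exp (Complex.I * lam * g.c + lam / 2 * (star g.z ⬝ᵥ z) - lam / 4 * (absSq g.z : ℂ)) *
    f (rot α (-g.t) (z - g.z))

theorem absSq_rot (t : Fin m → ℝ) (z : Fin n → ℂ) : absSq (rot α t z) = absSq z := by
  refine Finset.sum_congr rfl fun k _ => ?_
  rw [rot, norm_mul, mul_comm Complex.I, Complex.norm_exp_ofReal_mul_I, one_mul]

theorem measurePreserving_rot_sub (t : Fin m → ℝ) (z₀ : Fin n → ℂ) :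
    MeasurePreserving fun z : Fin n → ℂ => rot α t (z - z₀) := by
  have h1 : ∀ k : Fin n, MeasurePreserving
      (fun v : ℂ => Complex.exp (Complex.I * (α k t : ℂ)) * (v - z₀ k)) := by
    intro k
    have h2 := (rotation (Circle.exp (α k t))).measurePreserving
    have h3 := h2.comp (measurePreserving_sub_right (volume : Measure ℂ) (z₀ k))
    have e : ((rotation (Circle.exp (α k t)) : ℂ → ℂ) ∘ fun v => v - z₀ k)
        = fun v : ℂ => Complex.exp (Complex.I * (α k t : ℂ)) * (v - z₀ k) := by
      funext v
      simp [rotation_apply, Circle.coe_exp, mul_comm Complex.I]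
    rwa [e] at h3
  exact volume_preserving_pi h1

theorem absSq_sub (z w : Fin n → ℂ) :
    absSq (z - w) = absSq z + absSq w - 2 * (star w ⬝ᵥ z).re := by
  simp only [absSq, dotProduct, Complex.re_sum, Finset.mul_sum, ← Finset.sum_add_distrib,
    ← Finset.sum_sub_distrib]
  refine Finset.sum_congr rfl fun k _ => ?_
  simp only [← Complex.normSq_eq_norm_sq, Complex.normSq_apply]
  simp
  ring

theorem piFun_mem {lam : ℝ} [h : Fact (0 < lam)] (χ : AddChar (Fin m → ℝ) Circle) (g : Grp α)
    {f : (Fin n → ℂ) → ℂ} (hf : f ∈ fockSubmodule n lam) :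
    piFun lam χ g f ∈ fockSubmodule n lam := by
  have hd : Differentiable ℂ (piFun lam χ g f) := by
    have hr : Differentiable ℂ fun z : Fin n → ℂ => rot α (-g.t) (z - g.z) := by
      unfold rot; fun_prop
    have hfr := hf.1.comp hr
    simp only [Function.comp_def] at hfr
    have he : Differentiable ℂ fun z : Fin n → ℂ => Complex.exp (Complex.I * lam * g.c +
        lam / 2 * (star g.z ⬝ᵥ z) - lam / 4 * (absSq g.z : ℂ)) := by
      unfold dotProduct
      fun_prop
    exact (he.const_mul (χ g.t : ℂ)).mul hfr
  refine ⟨hd, (FockSpace.memLp_iff hd.continuous).2 ?_⟩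
  have h1 := (measurePreserving_rot_sub (α := α) (-g.t) g.z).integrable_comp_of_integrable
    ((FockSpace.memLp_iff hf.1.continuous).1 hf.2)
  refine h1.congr (Filter.Eventually.of_forall fun z => ?_)
  simp only [Function.comp_apply, piFun, norm_mul, Circle.norm_coe, one_mul, mul_pow,
    Complex.norm_exp, absSq_rot, ← Real.exp_nat_mul, ← mul_assoc, ← Real.exp_add]
  congr 2
  rw [absSq_sub]
  simp [-Complex.star_def]
  ring

theorem piFun_one (lam : ℝ) (χ : AddChar (Fin m → ℝ) Circle) (f : (Fin n → ℂ) → ℂ) :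
    piFun lam χ (1 : Grp α) f = f := by
  funext z
  simp [piFun, absSq, rot_zero]

theorem piFun_mul (lam : ℝ) (χ : AddChar (Fin m → ℝ) Circle) (g h : Grp α)
    (f : (Fin n → ℂ) → ℂ) :
    piFun lam χ (g * h) f = piFun lam χ g (piFun lam χ h f) := by
  funext z
  have e1 : rot α (-(g * h).t) (z - (g * h).z)
      = rot α (-h.t) (rot α (-g.t) (z - g.z) - h.z) := by
    rw [mul_t, mul_z, neg_add_rev, rot_add]
    congr 1
    rw [sub_add_eq_sub_sub, sub_eq_add_neg (z - g.z), rot_vadd, rot_neg, ← rot_add,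
      neg_add_cancel, rot_zero, ← sub_eq_add_neg]
  have hconj : ∀ k, (starRingEnd ℂ) (Complex.exp (Complex.I * (α k g.t : ℂ)))
      = Complex.exp (Complex.I * (α k (-g.t) : ℂ)) := fun k => by
    rw [← Complex.exp_conj]; simp
  simp only [piFun, e1, ← mul_assoc]
  congr 1
  rw [mul_t, AddChar.map_add_eq_mul, Circle.coe_mul]
  rw [show ∀ a b c d : ℂ, a * c * b * d = a * b * (c * d) by intros; ring, ← Complex.exp_add]
  congr 2
  have e2 : star (rot α g.t h.z) ⬝ᵥ z = star h.z ⬝ᵥ rot α (-g.t) z := by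
    refine Finset.sum_congr rfl fun k _ => ?_
    simp [rot, ← Complex.exp_conj]; ring
  have e3 : star (rot α g.t h.z) ⬝ᵥ g.z = star h.z ⬝ᵥ rot α (-g.t) g.z := by
    refine Finset.sum_congr rfl fun k _ => ?_
    simp [rot, ← Complex.exp_conj]; ring
  have e4 : absSq (g.z + rot α g.t h.z)
      = absSq g.z + absSq h.z + 2 * (star (rot α g.t h.z) ⬝ᵥ g.z).re := by
    have := absSq_sub g.z (-rot α g.t h.z)
    rw [sub_neg_eq_add] at this
    rw [this, ← rot_neg, absSq_rot, rot_neg]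
    simp [absSq]
  have e5 : ((omegaR g.z (rot α g.t h.z) : ℝ) : ℂ)
      = -((star (rot α g.t h.z) ⬝ᵥ g.z).im : ℂ) := by
    rw [omegaR_eq_sum, dotProduct, Complex.im_sum, ← Complex.ofReal_neg, ← Finset.sum_neg_distrib]
    congr 1
    refine Finset.sum_congr rfl fun k _ => ?_
    simp; ring
  rw [mul_c, mul_z, e4, star_add, add_dotProduct, e2, sub_eq_add_neg z g.z, rot_vadd, rot_neg,
    dotProduct_add, dotProduct_neg, ← e3]
  push_cast
  rw [e5]
  linear_combination (-(lam : ℂ) / 2) * (Complex.re_add_im (star (rot α g.t h.z) ⬝ᵥ g.z))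

/-- The representation `π` of `G` on the Fock space. -/
def piRep (α : Fin n → Module.Dual ℝ (Fin m → ℝ)) (lam : ℝ) [Fact (0 < lam)]
    (χ : AddChar (Fin m → ℝ) Circle) : Representation ℂ (Grp α) (FockSpace n lam) where
  toFun g :=
    { toFun := fun f => ⟨piFun lam χ g f.1, piFun_mem χ g f.2⟩
      map_add' := fun _ _ => FockSpace.ext fun _ => mul_add _ _ _
      map_smul' := fun a _ => FockSpace.ext fun _ => mul_left_comm _ a _ }
  map_one' := LinearMap.ext fun f => Subtype.ext (piFun_one lam χ f.1)
  map_mul' g h := LinearMap.ext fun f => Subtype.ext (piFun_mul lam χ g h f.1)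

/-- The differential `dπ(X) f = d/ds|_{s=0} π(exp(sX)) f`, the derivative being taken in the norm
of the Fock space; an unbounded operator, whose domain consists of all `f` for which it exists. -/
def dpi (α : Fin n → Module.Dual ℝ (Fin m → ℝ)) (lam : ℝ) [Fact (0 < lam)]
    (χ : AddChar (Fin m → ℝ) Circle) (X : LieAlg m n) : FockSpace n lam →ₗ.[ℂ] FockSpace n lam where
  domain :=
    { carrier := {f | DifferentiableAt ℝ (fun s : ℝ => piRep α lam χ (exp α (s • X)) f) 0}
      add_mem' := fun {f f'} hf hf' => by
        simp only [Set.mem_ofPred_eq, map_add] at *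
        exact hf.fun_add hf'
      zero_mem' := by simp
      smul_mem' := fun a f hf => by
        simp only [Set.mem_ofPred_eq, map_smul] at *
        exact hf.fun_const_smul a }
  toFun :=
    { toFun := fun f => deriv (fun s : ℝ => piRep α lam χ (exp α (s • X)) f.1) 0
      map_add' := fun f f' => by
        simp only [Submodule.coe_add, map_add]
        exact deriv_fun_add f.2 f'.2
      map_smul' := fun a f => by
        simp only [Submodule.coe_smul, map_smul, RingHom.id_apply]
        exact deriv_fun_const_smul a f.2 }

/-- The differential at `0` of the character `χ`, as a map `ℝᵐ → ℂ`. -/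
def dchi (χ : AddChar (Fin m → ℝ) Circle) : (Fin m → ℝ) →L[ℝ] ℂ :=
  fderiv ℝ (fun t => (χ t : ℂ)) 0

/-- The linear form `-i dχ` on `ℝᵐ`; it is real-valued, as `dχ` is imaginary. -/
def negIdchi (χ : AddChar (Fin m → ℝ) Circle) : Module.Dual ℝ (Fin m → ℝ) :=
  Complex.reLm ∘ₗ ((-Complex.I) • dchi χ : (Fin m → ℝ) →L[ℝ] ℂ).toLinearMap

end representation

/-! ### The complex Weyl symbol -/

section weyl
variable {n : ℕ} {lam : ℝ} [Fact (0 < lam)]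

open Classical in
/-- The kernel `k_A(z, w) = ⟨A e_w, e_z⟩` (linear in `A e_w`) of an operator `A` whose domain
contains the coherent states. -/
def kernel (A : FockSpace n lam →ₗ.[ℂ] FockSpace n lam) (z w : Fin n → ℂ) : ℂ :=
  if h : FockSpace.coherent n lam w ∈ A.domain then
    inner ℂ (FockSpace.coherent n lam z) (A ⟨FockSpace.coherent n lam w, h⟩)
  else 0

/-- `k_A(z+w, z-w) exp((λ/2)(-z z̄ - w w̄ + z w̄ - z̄ w))`. -/
def weylIntegrand (A : FockSpace n lam →ₗ.[ℂ] FockSpace n lam) (z w : Fin n → ℂ) : ℂ :=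
  kernel A (z + w) (z - w) *
    Complex.exp (lam / 2 * (-(z ⬝ᵥ star z) - w ⬝ᵥ star w + z ⬝ᵥ star w - star z ⬝ᵥ w))

/-- The complex Weyl symbol `W₀(A)`. -/
def W0 (A : FockSpace n lam →ₗ.[ℂ] FockSpace n lam) (z : Fin n → ℂ) : ℂ :=
  2 ^ n * ∫ w, weylIntegrand A z w ∂mu n lam

end weyl

end Diamond

namespace Diamond

/-! ### Continuous characters -/

/-! The group permutes coherent states up to scalars: `π(g) e_w = c(g, w) e_{g • w}`
(`piRep_coherent`). Since `w ↦ e_w` is real-differentiable into the Fock space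
(`hasFDerivAt_coherent`), `dπ(X) e_w` exists and equals the derivative of `e` along the velocity of
`X` at `w`, plus a scalar multiple of `e_w`. Pairing with `e_z` gives the kernel of `dπ(X)`: a
polynomial, affine in `z` and in `w̄`, times `exp(λ w̄ z / 2)` (`kernel_dpi`).

In the Weyl integrand all exponentials combine to `exp(-λ|w|²)`, leaving a polynomial of degree at
most two in `(w, w̄)` whose only quadratic terms are multiples of the `|w_k|²`. Linear terms
integrate to zero and `|w_k|²` has mean `1/λ`. So the symbol is the value of the polynomial at `w =
0` plus the correction `(i/2) ∑ α_k(t)`, which is the source of the half-sum of the `α_k` in `ψ`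
(`W0_dpi`).

Equivariance follows by computing `Ad` explicitly (`Ad_apply`) and checking that the pairing of `ψ(g
• z)` with `Ad(g) X` does not depend on `g` (`momentMap_smul_Ad`). Finally `ξ₀ = ψ(0)`, `G` acts
transitively on `ℂⁿ`, and `ψ` is injective because `ω` is nondegenerate and `λ ≠ 0`. -/

theorem differentiable_of_continuous_of_map_add {f : ℝ → ℂ} (hf : Continuous f) (h0 : f 0 = 1)
    (hadd : ∀ x y, f (x + y) = f x * f y) : Differentiable ℝ f := by
  -- Integrating `f (x + y) = f x * f y` over `y` from `0` to `δ` gives `F (x + δ) - F x = f x * F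
  -- δ`. Hence `f` inherits differentiability from its primitive as soon as `F δ ≠ 0`; such a `δ`
  -- exists because `F` has derivative `f 0 = 1` at `0`.
  set F : ℝ → ℂ := fun x => ∫ y in (0 : ℝ)..x, f y with hF
  have hFd : ∀ x, HasDerivAt F (f x) x := fun x => hf.integral_hasStrictDerivAt 0 x |>.hasDerivAt
  obtain ⟨δ, hδ⟩ : ∃ δ, F δ ≠ 0 := by
    by_contra! h
    have h1 := hFd 0
    rw [show F = fun _ => 0 from funext h, h0] at h1
    exact one_ne_zero (h1.unique (hasDerivAt_const _ _))
  have key : ∀ x, f x = (F (x + δ) - F x) / F δ := fun x => by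
    rw [eq_div_iff hδ, hF]
    simp only
    rw [intervalIntegral.integral_interval_sub_left (hf.intervalIntegrable _ _)
      (hf.intervalIntegrable _ _), ← intervalIntegral.integral_const_mul]
    simp only [← hadd]
    rw [intervalIntegral.integral_comp_add_left (fun y => f y), add_zero]
  rw [show f = fun x => (F (x + δ) - F x) / F δ from funext key]
  exact fun x => (((hFd (x + δ)).comp_add_const x δ).sub (hFd x)).div_const (F δ) |>.differentiableAt

section character
variable {m : ℕ} {χ : AddChar (Fin m → ℝ) Circle}

/-- A character of `ℝᵐ` is the product of its restrictions to the coordinate axes, so the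
one-variable case suffices. -/
theorem differentiable_addChar (hχ : Continuous χ) : Differentiable ℝ fun t => (χ t : ℂ) := by
  have h1 : ∀ t : Fin m → ℝ, (χ t : ℂ) = ∏ k, (χ (Pi.single k (t k)) : ℂ) := fun t => by
    conv_lhs => rw [← Finset.univ_sum_single t]
    exact map_prod (Circle.coeHom.comp χ.toMonoidHom)
      (fun k => Multiplicative.ofAdd (Pi.single k (t k) : Fin m → ℝ)) Finset.univ
  have h2 : ∀ k : Fin m, Differentiable ℝ fun x : ℝ => (χ (Pi.single k x) : ℂ) := fun k => by
    refine differentiable_of_continuous_of_map_add ?_ (by simp) fun x y => ?_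
    · exact continuous_subtype_val.comp (hχ.comp (continuous_single (A := fun _ : Fin m => ℝ) k))
    · rw [Pi.single_add, AddChar.map_add_eq_mul, Circle.coe_mul]
  rw [show (fun t => (χ t : ℂ)) = fun t => ∏ k, (χ (Pi.single k (t k)) : ℂ) from funext h1]
  intro t
  exact (HasFDerivAt.finsetProd fun k _ =>
    ((h2 k).comp (differentiable_apply k) t).hasFDerivAt).differentiableAt

theorem hasDerivAt_addChar_smul (hχ : Continuous χ) (t : Fin m → ℝ) :
    HasDerivAt (fun s : ℝ => (χ (s • t) : ℂ)) (dchi χ t) 0 := by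
  have h1 : HasFDerivAt (fun t => (χ t : ℂ)) (dchi χ) ((0 : ℝ) • t) := by
    rw [zero_smul]
    exact (differentiable_addChar hχ 0).hasFDerivAt
  have h2 : HasDerivAt (fun s : ℝ => s • t) t 0 := by
    simpa using (hasDerivAt_id (0 : ℝ)).smul_const t
  exact h1.comp_hasDerivAt 0 h2

theorem dchi_re (hχ : Continuous χ) (t : Fin m → ℝ) : (dchi χ t).re = 0 := by
  have h1 := hasDerivAt_addChar_smul hχ t
  -- Differentiating `χ χ̄ = 1` at `0` gives `dχ + conj dχ = 0`.
  have h2 := h1.mul h1.star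
  have h3 : ((fun s : ℝ => (χ (s • t) : ℂ)) * fun s : ℝ => star (χ (s • t) : ℂ)) = fun _ => 1 := by
    funext s
    simp [Complex.mul_conj, Circle.normSq_coe]
  rw [h3] at h2
  have h4 := congrArg Complex.re (h2.unique (hasDerivAt_const (0 : ℝ) (1 : ℂ)))
  simp at h4
  linarith

theorem negIdchi_eq (hχ : Continuous χ) (t : Fin m → ℝ) :
    (negIdchi χ t : ℂ) = -Complex.I * dchi χ t := by
  apply Complex.ext <;> simp [negIdchi, dchi_re hχ]

end character

/-! ### The adjoint action and the moment map -/

section coadjoint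
variable {m n : ℕ} {α : Fin n → Module.Dual ℝ (Fin m → ℝ)}

theorem hasFDerivAt_rot (z : Fin n → ℂ) :
    HasFDerivAt (fun t => rot α t z) (ContinuousLinearMap.pi fun k =>
      (Complex.ofRealCLM ∘L (α k).toContinuousLinearMap).smulRight (Complex.I * z k)) 0 := by
  refine hasFDerivAt_pi.2 fun k => ?_
  have h1 : HasFDerivAt (fun t => (α k t : ℂ)) (Complex.ofRealCLM ∘L (α k).toContinuousLinearMap) 0 :=
    ContinuousLinearMap.hasFDerivAt (Complex.ofRealCLM ∘L (α k).toContinuousLinearMap)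
  have h2 := ((h1.const_mul Complex.I).cexp).mul_const (z k)
  refine h2.congr_fderiv ?_
  ext t
  simp
  ring

/-- The bilinear form `ω` as a continuous bilinear map. -/
def omegaL (n : ℕ) : (Fin n → ℂ) →L[ℝ] (Fin n → ℂ) →L[ℝ] ℝ :=
  ∑ k, ((Complex.reCLM ∘L ContinuousLinearMap.proj k).smulRight
        (Complex.imCLM ∘L (ContinuousLinearMap.proj k : (Fin n → ℂ) →L[ℝ] ℂ)) -
      (Complex.imCLM ∘L ContinuousLinearMap.proj k).smulRight
        (Complex.reCLM ∘L (ContinuousLinearMap.proj k : (Fin n → ℂ) →L[ℝ] ℂ)))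

theorem omegaL_apply (z w : Fin n → ℂ) : omegaL n z w = omegaR z w := by
  simp [omegaL, omegaR_eq_sum]

theorem chart_conj (g : Grp α) (x : LieAlg m n) :
    chart (g * ofChart α x * g⁻¹) = (x.1, g.z + rot α g.t x.2.1 - rot α x.1 g.z,
      x.2.2 + 1 / 2 * omegaR g.z (rot α g.t x.2.1)
        - 1 / 2 * omegaR (g.z + rot α g.t x.2.1) (rot α x.1 g.z)) := by
  have h : rot α (g.t + x.1) (rot α (-g.t) g.z) = rot α x.1 g.z := by
    rw [← rot_add]; congr 1; abel
  have h' : ∀ a b : Fin n → ℂ, omegaR a (-b) = -omegaR a b := fun a b => by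
    simpa using omegaR_smul_right (-1) a b
  refine Prod.ext ?_ (Prod.ext ?_ ?_)
  · simp [chart, ofChart]
  · simp [chart, ofChart, rot_neg, h, sub_eq_add_neg]
  · simp [chart, ofChart, rot_neg, h, h']
    ring

/-- Differentiating `chart_conj` at `0`: the two halves of `ω(g.z, t·u)` add up by antisymmetry. The
quadratic term comes from the infinitesimal rotation of `g.z`, as `ω(z, iαz) = ∑ α_k |z_k|²`; it is
matched by the quadratic part of the moment map. -/
theorem Ad_apply (g : Grp α) (X : LieAlg m n) :
    Ad g X = (X.1, rot α g.t X.2.1 - (fun k => (α k X.1 : ℂ) * (Complex.I * g.z k)),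
      X.2.2 + omegaR g.z (rot α g.t X.2.1) - 1 / 2 * ∑ k, α k X.1 * ‖g.z k‖ ^ 2) := by
  set rotL : LieAlg m n →L[ℝ] (Fin n → ℂ) := ContinuousLinearMap.pi fun k =>
    Complex.exp (Complex.I * (α k g.t : ℂ)) • (ContinuousLinearMap.proj k ∘L
      ContinuousLinearMap.fst ℝ (Fin n → ℂ) ℝ ∘L
        ContinuousLinearMap.snd ℝ (Fin m → ℝ) ((Fin n → ℂ) × ℝ)) with hrotL
  have hrot : ∀ x : LieAlg m n, rotL x = rot α g.t x.2.1 := fun x => by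
    funext k; simp [hrotL, rot]
  have h1 : HasFDerivAt (fun x : LieAlg m n => rot α g.t x.2.1) rotL 0 := by
    simp only [← hrot]
    exact rotL.hasFDerivAt
  have h2 := (hasFDerivAt_rot (α := α) g.z).comp (0 : LieAlg m n)
    (hasFDerivAt_fst (𝕜 := ℝ) (p := (0 : LieAlg m n)))
  have h3 : HasFDerivAt (fun x : LieAlg m n => x.2.2) (ContinuousLinearMap.snd ℝ (Fin n → ℂ) ℝ ∘L
      ContinuousLinearMap.snd ℝ (Fin m → ℝ) ((Fin n → ℂ) × ℝ)) 0 :=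
    (ContinuousLinearMap.snd ℝ (Fin n → ℂ) ℝ ∘L
      ContinuousLinearMap.snd ℝ (Fin m → ℝ) ((Fin n → ℂ) × ℝ)).hasFDerivAt
  have h4 := h1.const_add g.z
  have h5 := (h3.add (((omegaL n g.z).hasFDerivAt.comp (0 : LieAlg m n) h1).const_mul
    (1 / 2 : ℝ))).sub (((omegaL n).hasFDerivAt_of_bilinear h4 h2).const_mul (1 / 2 : ℝ))
  have h6 := (hasFDerivAt_fst (𝕜 := ℝ) (p := (0 : LieAlg m n))).prodMk ((h4.sub h2).prodMk h5)
  have h7 := h6.congr_of_eventuallyEq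
    (f₁ := fun x : LieAlg m n => chart (g * ofChart α x * g⁻¹))
    (Filter.Eventually.of_forall fun x => by simp [chart_conj, omegaL_apply, omegaR_add_left])
  rw [Ad, h7.fderiv]
  have h8 : rot α g.t (0 : Fin n → ℂ) = 0 := by funext k; simp [rot]
  have h9 : omegaR (rot α g.t X.2.1) g.z = -omegaR g.z (rot α g.t X.2.1) := by
    simp only [omegaR_eq_sum, ← Finset.sum_neg_distrib]
    exact Finset.sum_congr rfl fun k _ => by ring
  have h10 : omegaR g.z (fun k => (α k X.1 : ℂ) * (Complex.I * g.z k))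
      = ∑ k, α k X.1 * ‖g.z k‖ ^ 2 := by
    simp only [omegaR_eq_sum, ← Complex.normSq_eq_norm_sq, Complex.normSq_apply]
    exact Finset.sum_congr rfl fun k _ => by simp; ring
  refine Prod.ext rfl (Prod.ext ?_ ?_)
  · funext k
    simp [hrot]
  · rw [← h10]
    simp [omegaL_apply, hrot, h8, h9, rot_zero]
    ring

/-- The moment map `ψ`. -/
def momentMap (α : Fin n → Module.Dual ℝ (Fin m → ℝ)) (lam : ℝ) (χ : AddChar (Fin m → ℝ) Circle)
    (z : Fin n → ℂ) : Module.Dual ℝ (LieAlg m n) :=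
  dualElt (negIdchi χ + (1 / 2 : ℝ) • ∑ k, (1 - lam * ‖z k‖ ^ 2) • α k) (-(lam • z)) lam

theorem momentMap_apply (lam : ℝ) (χ : AddChar (Fin m → ℝ) Circle) (z : Fin n → ℂ)
    (X : LieAlg m n) : momentMap α lam χ z X =
      negIdchi χ X.1 + 1 / 2 * ∑ k, (1 - lam * ‖z k‖ ^ 2) * α k X.1
        - lam * omegaR z X.2.1 + lam * X.2.2 := by
  have h : omegaR (-(lam • z)) X.2.1 = -(lam * omegaR z X.2.1) := by
    simp only [omegaR_eq_sum, Finset.mul_sum, ← Finset.sum_neg_distrib]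
    exact Finset.sum_congr rfl fun k _ => by simp; ring
  simp [momentMap, dualElt, h]
  ring

/-- Rotations preserve `|z_k|` and `ω`, so `z` and `u` enter only in rotated form and may be
replaced by arbitrary vectors. For the translation part, the cross terms of `|z' + g.z|²` cancel
against `ω(z', iα g.z)`, and the three multiples of `∑ α_k |g.z k|²` sum to zero. -/
theorem momentMap_smul_Ad (lam : ℝ) (χ : AddChar (Fin m → ℝ) Circle) (g : Grp α) (z : Fin n → ℂ)
    (X : LieAlg m n) : momentMap α lam χ (g • z) (Ad g X) = momentMap α lam χ z X := by
  rw [momentMap_apply, momentMap_apply, Ad_apply, smul_def, ← omegaR_rot (α := α) g.t z X.2.1]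
  have h : ∀ k, ‖z k‖ = ‖rot α g.t z k‖ := fun k => by
    rw [rot, norm_mul, mul_comm Complex.I, Complex.norm_exp_ofReal_mul_I, one_mul]
  simp only [h]
  generalize rot α g.t z = z', rot α g.t X.2.1 = u
  have key : 1 / 2 * ∑ k, (1 - lam * ‖(z' + g.z) k‖ ^ 2) * α k X.1
      - lam * omegaR (z' + g.z) (u - fun k => (α k X.1 : ℂ) * (Complex.I * g.z k))
      + lam * (omegaR g.z u - 1 / 2 * ∑ k, α k X.1 * ‖g.z k‖ ^ 2)
      = 1 / 2 * ∑ k, (1 - lam * ‖z' k‖ ^ 2) * α k X.1 - lam * omegaR z' u := by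
    simp only [omegaR_eq_sum, Finset.mul_sum, ← Finset.sum_add_distrib, ← Finset.sum_sub_distrib]
    refine Finset.sum_congr rfl fun k _ => ?_
    simp only [← Complex.normSq_eq_norm_sq, Complex.normSq_apply]
    simp
    ring
  linear_combination key

theorem momentMap_smul (lam : ℝ) (χ : AddChar (Fin m → ℝ) Circle) (g : Grp α) (z : Fin n → ℂ) :
    momentMap α lam χ (g • z) = coAd g (momentMap α lam χ z) := by
  refine LinearMap.ext fun X => ?_
  -- Invariance is used for `g⁻¹` at the point `g • z`, since `coAd g` is composition with `Ad g⁻¹`;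
  -- multiplicativity of `Ad` is not needed.
  rw [← momentMap_smul_Ad lam χ g⁻¹, inv_smul_smul]
  rfl

theorem momentMap_injective {lam : ℝ} (hlam : 0 < lam) (χ : AddChar (Fin m → ℝ) Circle) :
    Function.Injective (momentMap α lam χ) := fun z w h => by
  -- On vectors `(0, u, 0)` only the `ω` term survives, with factor `-λ ≠ 0`; testing on `I` and `1`
  -- in slot `k` then reads off the real and imaginary parts of `z k`.
  have h1 : ∀ u : Fin n → ℂ, omegaR z u = omegaR w u := fun u => by
    have := congrArg (fun ξ => ξ ((0, u, 0) : LieAlg m n)) h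
    simpa [momentMap_apply, hlam.ne'] using this
  have h2 : ∀ (z : Fin n → ℂ) (k : Fin n) (a : ℂ),
      omegaR z (Pi.single k a) = (z k).re * a.im - (z k).im * a.re := fun z k a => by
    rw [omegaR_eq_sum, Finset.sum_eq_single k]
    · simp
    · intro j _ hj; simp [Pi.single_eq_of_ne hj]
    · simp
  funext k
  apply Complex.ext
  · simpa [h2] using h1 (Pi.single k Complex.I)
  · simpa [h2] using h1 (Pi.single k 1)

/-- The base point is `ψ(0)` and the elements `(0, z, 0)` already carry `0` to every `z`, so
equivariance identifies the image of `ψ` with the orbit. -/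
theorem momentMap_bijOn {lam : ℝ} (hlam : 0 < lam) (χ : AddChar (Fin m → ℝ) Circle) :
    Set.BijOn (momentMap α lam χ) Set.univ (coadjointOrbit α
      (dualElt (negIdchi χ + (1 / 2 : ℝ) • ∑ k, α k) 0 lam)) := by
  have h0 : dualElt (negIdchi χ + (1 / 2 : ℝ) • ∑ k, α k) 0 lam = momentMap α lam χ 0 := by
    simp [momentMap]
  have h1 : ∀ z : Fin n → ℂ, (⟨0, z, 0⟩ : Grp α) • (0 : Fin n → ℂ) = z := fun z => by
    simp [smul_def, rot_zero]
  rw [h0]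
  refine ⟨fun z _ => ⟨⟨0, z, 0⟩, ?_⟩, (momentMap_injective hlam χ).injOn, ?_⟩
  · simp only [← momentMap_smul, h1]
  · rintro _ ⟨g, rfl⟩
    exact ⟨g • 0, trivial, momentMap_smul lam χ g 0⟩

end coadjoint

/-! ### Gaussian integrals -/

/-- With `v = x + iy` the integral splits into two real Gaussians with linear coefficients `p + q`
and `i(p - q)`; completing squares leaves `((p + q)² - (p - q)²) / 4b = pq / b`. -/
theorem integral_cexp_neg_mul_normSq_add {b : ℝ} (hb : 0 < b) (p q : ℂ) :
    ∫ v : ℂ, Complex.exp (-b * (‖v‖ : ℂ) ^ 2 + p * v + q * star v)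
      = Real.pi / b * Complex.exp (p * q / b) := by
  have hre : (-(b : ℂ)).re < 0 := by simpa using hb
  have hbc : (b : ℂ) ≠ 0 := by exact_mod_cast hb.ne'
  have hpi : (Real.pi : ℂ) ≠ 0 := by exact_mod_cast Real.pi_ne_zero
  have h1 : ∀ x : ℝ × ℝ, Complex.exp (-b * (‖Complex.measurableEquivRealProd.symm x‖ : ℂ) ^ 2
      + p * Complex.measurableEquivRealProd.symm x + q * star (Complex.measurableEquivRealProd.symm x))
      = Complex.exp (-b * (x.1 : ℂ) ^ 2 + (p + q) * x.1 + 0)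
        * Complex.exp (-b * (x.2 : ℂ) ^ 2 + (Complex.I * (p - q)) * x.2 + 0) := fun x => by
    have h2 : Complex.measurableEquivRealProd.symm x = (x.1 : ℂ) + x.2 * Complex.I := by
      apply Complex.ext <;> simp
    have h3 : ((‖Complex.measurableEquivRealProd.symm x‖ : ℝ) : ℂ) ^ 2
        = (x.1 : ℂ) ^ 2 + (x.2 : ℂ) ^ 2 := by
      rw [← Complex.ofReal_pow, ← Complex.normSq_eq_norm_sq, Complex.normSq_apply]
      simp
      ring
    rw [h3, h2, ← Complex.exp_add]
    congr 1
    simp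
    ring
  rw [← (Complex.volume_preserving_equiv_real_prod.symm _).integral_comp'
    (g := fun v : ℂ => Complex.exp (-b * (‖v‖ : ℂ) ^ 2 + p * v + q * star v))]
  simp only [h1]
  rw [Measure.volume_eq_prod,
    integral_prod_mul (fun x : ℝ => Complex.exp (-b * (x : ℂ) ^ 2 + (p + q) * x + 0))
      (fun x : ℝ => Complex.exp (-b * (x : ℂ) ^ 2 + (Complex.I * (p - q)) * x + 0)),
    integral_cexp_quadratic hre, integral_cexp_quadratic hre, neg_neg]
  have h4 : (Real.pi / b : ℂ) ^ (1 / 2 : ℂ) * (Real.pi / b : ℂ) ^ (1 / 2 : ℂ) = Real.pi / b := by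
    rw [← Complex.cpow_add _ _ (div_ne_zero hpi hbc)]
    norm_num
  rw [mul_mul_mul_comm, h4, ← Complex.exp_add]
  congr 2
  field_simp
  linear_combination (p - q) ^ 2 * Complex.I_sq

theorem integral_gaussian {b : ℝ} (hb : 0 < b) :
    ∫ v : ℂ, Complex.exp (-b * (‖v‖ : ℂ) ^ 2) = Real.pi / b := by
  simpa using integral_cexp_neg_mul_normSq_add hb 0 0

theorem integrable_gaussian {b : ℝ} (hb : 0 < b) :
    Integrable fun v : ℂ => Real.exp (-b * ‖v‖ ^ 2) := by
  have := (GaussianFourier.integrable_cexp_neg_mul_sq_norm_add (b := (b : ℂ)) (by simpa using hb)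
    0 (0 : ℂ)).norm
  refine this.congr (Filter.Eventually.of_forall fun v => ?_)
  simp [Complex.norm_exp, ← Complex.ofReal_pow]

theorem integral_sq_norm_mul_gaussian {b : ℝ} (hb : 0 < b) :
    ∫ v : ℂ, ‖v‖ ^ 2 * Real.exp (-b * ‖v‖ ^ 2) = Real.pi / b ^ 2 := by
  have h := Complex.integral_rpow_mul_exp_neg_mul_rpow (p := 2) (q := 2) (b := b)
    (by norm_num) (by norm_num) hb
  simp only [Real.rpow_two] at h
  rw [h]
  norm_num
  rfl

theorem integrable_sq_norm_mul_gaussian {b : ℝ} (hb : 0 < b) :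
    Integrable fun v : ℂ => ‖v‖ ^ 2 * Real.exp (-b * ‖v‖ ^ 2) := by
  -- The integral of a non-integrable function is `0` by convention, so the nonzero value `π / b²`
  -- forces integrability.
  by_contra h
  have h1 := integral_sq_norm_mul_gaussian hb
  rw [integral_undef h] at h1
  have : 0 < Real.pi / b ^ 2 := by positivity
  linarith

/-- The quadratic polynomial `(v, v̄) ↦ a + p v + q v̄ + r v v̄` is integrable against a Gaussian. -/
theorem integrable_quadratic_mul_gaussian {b : ℝ} (hb : 0 < b) (a p q r : ℂ) :
    Integrable fun v : ℂ => (a + p * v + q * star v + r * (‖v‖ : ℂ) ^ 2)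
      * Complex.exp (-b * (‖v‖ : ℂ) ^ 2) := by
  -- The linear terms are absorbed by `‖v‖ ≤ 1 + ‖v‖²`, hence `‖p‖ + ‖q‖` occurs in both
  -- coefficients of the dominating function.
  have h1 := ((integrable_gaussian hb).const_mul (‖a‖ + (‖p‖ + ‖q‖))).add
    ((integrable_sq_norm_mul_gaussian hb).const_mul (‖p‖ + ‖q‖ + ‖r‖))
  refine h1.mono' (by fun_prop) (Filter.Eventually.of_forall fun v => ?_)
  have h2 : ‖Complex.exp (-b * (‖v‖ : ℂ) ^ 2)‖ = Real.exp (-b * ‖v‖ ^ 2) := by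
    simp [Complex.norm_exp, ← Complex.ofReal_pow]
  have h3 : ‖a + p * v + q * star v + r * (‖v‖ : ℂ) ^ 2‖
      ≤ ‖a‖ + ‖p‖ * ‖v‖ + ‖q‖ * ‖v‖ + ‖r‖ * ‖v‖ ^ 2 := by
    refine (norm_add_le _ _).trans (add_le_add ((norm_add_le _ _).trans
      (add_le_add ((norm_add_le _ _).trans ?_) ?_)) ?_) <;> simp
  rw [norm_mul, h2]
  refine (mul_le_mul_of_nonneg_right h3 (Real.exp_pos _).le).trans ?_
  simp only [Pi.add_apply]
  rw [← mul_assoc, ← add_mul]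
  refine mul_le_mul_of_nonneg_right ?_ (Real.exp_pos _).le
  have h4 : ‖v‖ ≤ 1 + ‖v‖ ^ 2 := by nlinarith [sq_nonneg (‖v‖ - 1), sq_nonneg ‖v‖]
  nlinarith [mul_le_mul_of_nonneg_left h4 (add_nonneg (norm_nonneg p) (norm_nonneg q))]

theorem integral_quadratic_mul_gaussian {b : ℝ} (hb : 0 < b) (a p q r : ℂ) :
    ∫ v : ℂ, (a + p * v + q * star v + r * (‖v‖ : ℂ) ^ 2) * Complex.exp (-b * (‖v‖ : ℂ) ^ 2)
      = Real.pi / b * (a + r / b) := by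
  -- The linear part is odd under `v ↦ -v`. Each part keeps the full quadratic shape, with zero
  -- coefficients, so that the same integrability lemma covers all of them.
  have hodd : ∫ v : ℂ, (0 + p * v + q * star v + 0 * (‖v‖ : ℂ) ^ 2)
      * Complex.exp (-b * (‖v‖ : ℂ) ^ 2) = 0 := by
    have h := integral_neg_eq_self (fun v : ℂ => (0 + p * v + q * star v + 0 * (‖v‖ : ℂ) ^ 2)
      * Complex.exp (-b * (‖v‖ : ℂ) ^ 2)) volume
    rw [← self_eq_neg, ← integral_neg, ← h]
    congr 1
    funext v
    simp
    ring
  have hsq : ∫ v : ℂ, (‖v‖ : ℂ) ^ 2 * Complex.exp (-b * (‖v‖ : ℂ) ^ 2) = Real.pi / b ^ 2 := by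
    have h := congrArg (Complex.ofReal) (integral_sq_norm_mul_gaussian hb)
    rw [← integral_complex_ofReal] at h
    simpa using h
  have h1 : ∀ v : ℂ, (a + p * v + q * star v + r * (‖v‖ : ℂ) ^ 2) * Complex.exp (-b * (‖v‖ : ℂ) ^ 2)
      = (a + 0 * v + 0 * star v + r * (‖v‖ : ℂ) ^ 2) * Complex.exp (-b * (‖v‖ : ℂ) ^ 2)
      + (0 + p * v + q * star v + 0 * (‖v‖ : ℂ) ^ 2) * Complex.exp (-b * (‖v‖ : ℂ) ^ 2) :=
    fun v => by ring
  have h2 : ∀ v : ℂ, (a + 0 * v + 0 * star v + r * (‖v‖ : ℂ) ^ 2)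
        * Complex.exp (-b * (‖v‖ : ℂ) ^ 2)
      = (a + 0 * v + 0 * star v + 0 * (‖v‖ : ℂ) ^ 2) * Complex.exp (-b * (‖v‖ : ℂ) ^ 2)
      + (0 + 0 * v + 0 * star v + r * (‖v‖ : ℂ) ^ 2) * Complex.exp (-b * (‖v‖ : ℂ) ^ 2) :=
    fun v => by ring
  simp only [h1]
  rw [integral_add (integrable_quadratic_mul_gaussian hb a 0 0 r)
    (integrable_quadratic_mul_gaussian hb 0 p q 0), hodd, add_zero]
  simp only [h2]
  rw [integral_add (integrable_quadratic_mul_gaussian hb a 0 0 0)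
    (integrable_quadratic_mul_gaussian hb 0 0 0 r)]
  simp only [zero_mul, add_zero, zero_add, mul_assoc, integral_const_mul, integral_gaussian hb, hsq]
  have hbc : (b : ℂ) ≠ 0 := by exact_mod_cast hb.ne'
  field_simp

/-! ### Gaussian integrals over `ℂⁿ`, by factorisation over the coordinates -/

section pi
variable {n : ℕ}

theorem cexp_neg_mul_absSq (b : ℝ) (w : Fin n → ℂ) :
    Complex.exp (-b * (absSq w : ℂ)) = ∏ k, Complex.exp (-b * (‖w k‖ : ℂ) ^ 2) := by
  rw [← Complex.exp_sum, absSq]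
  push_cast
  rw [Finset.mul_sum]

/-- A function of one coordinate times the Gaussian is again a product over the coordinates, which
is the form Fubini needs. -/
theorem mul_cexp_neg_mul_absSq (b : ℝ) (j : Fin n) (g : ℂ → ℂ) (w : Fin n → ℂ) :
    g (w j) * Complex.exp (-b * (absSq w : ℂ))
      = ∏ k, (if k = j then g (w k) else 1) * Complex.exp (-b * (‖w k‖ : ℂ) ^ 2) := by
  rw [cexp_neg_mul_absSq, Finset.prod_mul_distrib]
  simp

theorem integrable_ite_gaussian {b : ℝ} (hb : 0 < b) {g : ℂ → ℂ}
    (hg : Integrable fun v : ℂ => g v * Complex.exp (-b * (‖v‖ : ℂ) ^ 2)) (P : Prop) [Decidable P] :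
    Integrable fun v : ℂ => (if P then g v else 1) * Complex.exp (-b * (‖v‖ : ℂ) ^ 2) := by
  by_cases h : P
  · simpa [h] using hg
  · simpa [h] using integrable_quadratic_mul_gaussian hb 1 0 0 0

theorem integrable_mul_cexp_neg_mul_absSq {b : ℝ} (hb : 0 < b) (j : Fin n) {g : ℂ → ℂ}
    (hg : Integrable fun v : ℂ => g v * Complex.exp (-b * (‖v‖ : ℂ) ^ 2)) :
    Integrable fun w : Fin n → ℂ => g (w j) * Complex.exp (-b * (absSq w : ℂ)) := by
  simp only [mul_cexp_neg_mul_absSq]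
  exact Integrable.fintype_prod (μ := fun _ : Fin n => (volume : Measure ℂ))
    (f := fun k v => (if k = j then g v else 1) * Complex.exp (-b * (‖v‖ : ℂ) ^ 2))
    fun k => integrable_ite_gaussian hb hg (k = j)

theorem integral_mul_cexp_neg_mul_absSq {b : ℝ} (hb : 0 < b) (j : Fin n) (g : ℂ → ℂ) {I : ℂ}
    (hI : ∫ v : ℂ, g v * Complex.exp (-b * (‖v‖ : ℂ) ^ 2) = Real.pi / b * I) :
    ∫ w : Fin n → ℂ, g (w j) * Complex.exp (-b * (absSq w : ℂ)) = (Real.pi / b) ^ n * I := by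
  simp only [mul_cexp_neg_mul_absSq]
  rw [integral_fintype_prod_volume_eq_prod
    (fun k v => (if k = j then g v else 1) * Complex.exp (-b * (‖v‖ : ℂ) ^ 2))]
  have h : ∀ k, ∫ v : ℂ, (if k = j then g v else 1) * Complex.exp (-b * (‖v‖ : ℂ) ^ 2)
      = Real.pi / b * if k = j then I else 1 := fun k => by
    by_cases h : k = j
    · simpa only [h, if_true] using hI
    · simpa only [h, if_false, one_mul, mul_one] using integral_gaussian hb
  simp only [h, Finset.prod_mul_distrib, Finset.prod_const, Finset.card_univ, Fintype.card_fin,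
    Finset.prod_ite_eq', Finset.mem_univ, if_true]

theorem integrable_cexp_neg_mul_absSq {b : ℝ} (hb : 0 < b) :
    Integrable fun w : Fin n → ℂ => Complex.exp (-b * (absSq w : ℂ)) := by
  simp only [cexp_neg_mul_absSq]
  exact Integrable.fintype_prod (μ := fun _ : Fin n => (volume : Measure ℂ))
    (f := fun _ v => Complex.exp (-b * (‖v‖ : ℂ) ^ 2))
    fun k => by simpa using integrable_quadratic_mul_gaussian hb 1 0 0 0

theorem integral_cexp_neg_mul_absSq {b : ℝ} (hb : 0 < b) :
    ∫ w : Fin n → ℂ, Complex.exp (-b * (absSq w : ℂ)) = (Real.pi / b) ^ n := by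
  simp only [cexp_neg_mul_absSq]
  rw [integral_fintype_prod_volume_eq_prod (fun _ v => Complex.exp (-b * (‖v‖ : ℂ) ^ 2))]
  simp only [integral_gaussian hb, Finset.prod_const, Finset.card_univ, Fintype.card_fin]

/-- This is the shape of the Weyl integrand. The constant `A` stands apart because it could not be
absorbed into the `a k` when `n = 0`. -/
theorem integrable_sum_quadratic_mul_gaussian {b : ℝ} (hb : 0 < b) (A : ℂ) (a p q r : Fin n → ℂ) :
    Integrable fun w : Fin n → ℂ => A * Complex.exp (-b * (absSq w : ℂ))
      + ∑ k, (a k + p k * w k + q k * star (w k) + r k * (‖w k‖ : ℂ) ^ 2)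
        * Complex.exp (-b * (absSq w : ℂ)) :=
  ((integrable_cexp_neg_mul_absSq hb).const_mul A).add (integrable_finsetSum _ fun k _ =>
    integrable_mul_cexp_neg_mul_absSq hb k
      (integrable_quadratic_mul_gaussian hb (a k) (p k) (q k) (r k)))

theorem integral_sum_quadratic_mul_gaussian {b : ℝ} (hb : 0 < b) (A : ℂ) (a p q r : Fin n → ℂ) :
    ∫ w : Fin n → ℂ, (A * Complex.exp (-b * (absSq w : ℂ))
      + ∑ k, (a k + p k * w k + q k * star (w k) + r k * (‖w k‖ : ℂ) ^ 2)
        * Complex.exp (-b * (absSq w : ℂ)))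
      = (Real.pi / b) ^ n * (A + ∑ k, (a k + r k / b)) := by
  have h := fun k : Fin n => integrable_mul_cexp_neg_mul_absSq hb k
    (integrable_quadratic_mul_gaussian hb (a k) (p k) (q k) (r k))
  rw [integral_add ((integrable_cexp_neg_mul_absSq hb).const_mul A)
    (integrable_finsetSum _ fun k _ => h k), integral_finsetSum _ fun k _ => h k,
    integral_const_mul, integral_cexp_neg_mul_absSq hb, mul_add, Finset.mul_sum, mul_comm A]
  congr 1
  exact Finset.sum_congr rfl fun k _ => integral_mul_cexp_neg_mul_absSq hb k
    (fun v => a k + p k * v + q k * star v + r k * (‖v‖ : ℂ) ^ 2)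
    (integral_quadratic_mul_gaussian hb (a k) (p k) (q k) (r k))

end pi

/-! ### Coherent states -/

namespace FockSpace
variable {n : ℕ} {lam : ℝ}

theorem integral_fockMeasure [h : Fact (0 < lam)] (f : (Fin n → ℂ) → ℂ) :
    ∫ z, f z ∂fockMeasure n lam
      = (lam / (2 * Real.pi)) ^ n * ∫ z, Complex.exp (-(lam / 2 : ℝ) * (absSq z : ℂ)) * f z := by
  have hm : Measurable fun z : Fin n → ℂ => ENNReal.ofReal (Real.exp (-lam * absSq z / 2)) := by
    have := (continuous_absSq (n := n)).measurable
    fun_prop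
  rw [fockMeasure, integral_withDensity_eq_integral_toReal_smul hm
    (Filter.Eventually.of_forall fun _ => ENNReal.ofReal_lt_top), mu, integral_smul_measure,
    ENNReal.toReal_ofReal const_pos.le, Complex.real_smul]
  push_cast
  congr 2
  funext z
  rw [ENNReal.toReal_ofReal (Real.exp_pos _).le, Complex.real_smul]
  push_cast
  congr 2
  ring

/-- The integrand factors into one-variable Gaussians with `b = λ/2`, `p = λ w̄_k / 2`, `q = λ z_k /
2`, so `pq/b = λ w̄_k z_k / 2`; the normalisation of `mu` cancels the factors `π/b`. -/
theorem inner_coherent [h : Fact (0 < lam)] (z w : Fin n → ℂ) :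
    inner ℂ (coherent n lam z) (coherent n lam w) = Complex.exp (lam / 2 * (star w ⬝ᵥ z)) := by
  have hl : (lam : ℂ) ≠ 0 := by exact_mod_cast h.out.ne'
  have hpi : (Real.pi : ℂ) ≠ 0 := by exact_mod_cast Real.pi_ne_zero
  have h1 : ∀ v : Fin n → ℂ, Complex.exp (-(lam / 2 : ℝ) * (absSq v : ℂ)) *
      (star (coherent n lam z v) * coherent n lam w v)
      = ∏ k, Complex.exp (-(lam / 2 : ℝ) * (‖v k‖ : ℂ) ^ 2 + (lam / 2 * star (w k)) * v k
        + (lam / 2 * z k) * star (v k)) := fun v => by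
    have h2 : star (coherent n lam z v) = Complex.exp (lam * (z ⬝ᵥ star v) / 2) := by
      change star (Complex.exp _) = _
      rw [Complex.star_def, ← Complex.exp_conj]
      simp [dotProduct, map_ofNat]
    have h3 : coherent n lam w v = Complex.exp (lam * (star w ⬝ᵥ v) / 2) := rfl
    rw [h2, h3, cexp_neg_mul_absSq, ← Complex.exp_sum, ← Complex.exp_sum, ← Complex.exp_add,
      ← Complex.exp_add]
    congr 1
    simp only [dotProduct, Finset.mul_sum, Finset.sum_div, ← Finset.sum_add_distrib]
    refine Finset.sum_congr rfl fun k _ => ?_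
    simp
    ring
  rw [inner_def, integral_fockMeasure]
  simp only [h1]
  rw [integral_fintype_prod_volume_eq_prod (fun k v => Complex.exp (-(lam / 2 : ℝ) * (‖v‖ : ℂ) ^ 2
    + (lam / 2 * star (w k)) * v + (lam / 2 * z k) * star v))]
  simp only [integral_cexp_neg_mul_normSq_add (half_pos h.out), Finset.prod_mul_distrib,
    Finset.prod_const, Finset.card_univ, Fintype.card_fin, ← Complex.exp_sum]
  rw [← mul_assoc, ← mul_pow, show (lam / (2 * Real.pi) * (Real.pi / (lam / 2 : ℝ)) : ℂ) = 1 by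
    push_cast; field_simp, one_pow, one_mul, dotProduct, Finset.mul_sum]
  congr 1
  refine Finset.sum_congr rfl fun k _ => ?_
  push_cast
  simp only [Pi.star_apply]
  field_simp

/-- Exponential growth is harmless against the Gaussian weight. The sum `∑ ‖z k‖`, unlike the
Euclidean norm, makes this dominating function a product over the coordinates. -/
theorem memLp_exp_mul_sum_norm [h : Fact (0 < lam)] (C : ℝ) :
    MemLp (fun z : Fin n → ℂ => ((Real.exp (C * ∑ k, ‖z k‖) : ℝ) : ℂ)) 2 (fockMeasure n lam) := by
  have hlam := h.out
  refine (memLp_iff (by fun_prop)).2 ?_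
  have h1 : Integrable fun v : ℂ => Real.exp (-(lam / 2) * ‖v‖ ^ 2 + 2 * C * ‖v‖) := by
    -- Half of the Gaussian is spent on the linear term: completing the square gives `2C‖v‖ ≤
    -- (λ/4)‖v‖² + 4C²/λ`.
    have h2 := (integrable_gaussian (b := lam / 4) (by linarith)).const_mul
      (Real.exp (4 * C ^ 2 / lam))
    refine h2.mono' (by fun_prop) (Filter.Eventually.of_forall fun v => ?_)
    rw [Real.norm_eq_abs, Real.abs_exp, ← Real.exp_add, Real.exp_le_exp]
    have h3 : 0 ≤ (lam / 2 * ‖v‖ - 2 * C) ^ 2 / lam := by positivity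
    have h4 : (lam / 2 * ‖v‖ - 2 * C) ^ 2 / lam
        = lam / 4 * ‖v‖ ^ 2 - 2 * C * ‖v‖ + 4 * C ^ 2 / lam := by
      field_simp; ring
    linarith
  refine (Integrable.fintype_prod (μ := fun _ : Fin n => (volume : Measure ℂ))
    (f := fun _ v => Real.exp (-(lam / 2) * ‖v‖ ^ 2 + 2 * C * ‖v‖)) fun _ => h1).congr
    (Filter.Eventually.of_forall fun z => ?_)
  simp only [Complex.norm_real, Real.norm_eq_abs, Real.abs_exp, ← Real.exp_nat_mul, ← Real.exp_add,
    ← Real.exp_sum, absSq, Finset.mul_sum, Finset.sum_div, ← Finset.sum_add_distrib]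
  congr 1
  refine Finset.sum_congr rfl fun k _ => ?_
  push_cast
  ring

theorem mem_fockSubmodule_of_norm_le [Fact (0 < lam)] {f : (Fin n → ℂ) → ℂ}
    (hf : Differentiable ℂ f) {c C : ℝ}
    (hle : ∀ z, ‖f z‖ ≤ c * Real.exp (C * ∑ k, ‖z k‖)) : f ∈ fockSubmodule n lam :=
  ⟨hf, (memLp_exp_mul_sum_norm C).of_le_mul (c := c) hf.continuous.aestronglyMeasurable
    (Filter.Eventually.of_forall fun z => by
      rw [Complex.norm_real, Real.norm_eq_abs, Real.abs_exp]; exact hle z)⟩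

theorem norm_eq_norm_toLp [Fact (0 < lam)] (f : FockSpace n lam) :
    ‖f‖ = ‖f.memLp.toLp _‖ := by
  rw [@norm_eq_sqrt_re_inner ℂ, @norm_eq_sqrt_re_inner ℂ, ← inner_eq_toLp]

/-- For fixed `C` this turns a pointwise bound into a norm bound linear in `c`, which is how
differentiability in the Fock norm is reduced to pointwise estimates. -/
theorem norm_le_of_norm_apply_le [Fact (0 < lam)] (f : FockSpace n lam) {c C : ℝ}
    (hle : ∀ z, ‖f z‖ ≤ c * Real.exp (C * ∑ k, ‖z k‖)) :
    ‖f‖ ≤ c * ‖(memLp_exp_mul_sum_norm (n := n) (lam := lam) C).toLp _‖ := by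
  rw [norm_eq_norm_toLp]
  refine Lp.norm_le_mul_norm_of_ae_le_mul ?_
  filter_upwards [f.memLp.coeFn_toLp,
    (memLp_exp_mul_sum_norm (n := n) (lam := lam) C).coeFn_toLp] with z h1 h2
  rw [h1, h2, Complex.norm_real, Real.norm_eq_abs, Real.abs_exp]
  exact hle z

theorem norm_star_dotProduct_le (v z : Fin n → ℂ) : ‖star v ⬝ᵥ z‖ ≤ ‖v‖ * ∑ k, ‖z k‖ := by
  rw [dotProduct, Finset.mul_sum]
  refine (norm_sum_le _ _).trans (Finset.sum_le_sum fun k _ => ?_)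
  rw [norm_mul, Pi.star_apply, norm_star]
  exact mul_le_mul_of_nonneg_right (norm_le_pi_norm v k) (norm_nonneg _)

theorem norm_coherentFun_le (hlam : 0 < lam) (w z : Fin n → ℂ) :
    ‖coherentFun lam w z‖ ≤ Real.exp (lam / 2 * ‖w‖ * ∑ k, ‖z k‖) := by
  rw [coherentFun, Complex.norm_exp, Real.exp_le_exp]
  refine (Complex.re_le_norm _).trans ?_
  rw [norm_div, norm_mul, Complex.norm_real, Real.norm_of_nonneg hlam.le, Complex.norm_two]
  have := mul_le_mul_of_nonneg_left (norm_star_dotProduct_le w z) hlam.le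
  linarith

/-- `v ↦ (λ/2) (v̄ z) e_w(z)`, the derivative of `w ↦ e_w(z)` in the direction `v`. -/
def coherentDerivFun (lam : ℝ) (w v z : Fin n → ℂ) : ℂ :=
  lam / 2 * (star v ⬝ᵥ z) * coherentFun lam w z

theorem coherentDerivFun_mem [h : Fact (0 < lam)] (w v : Fin n → ℂ) :
    coherentDerivFun lam w v ∈ fockSubmodule n lam := by
  have hlam := h.out
  have hd : Differentiable ℂ (coherentDerivFun lam w v) := by
    unfold coherentDerivFun coherentFun dotProduct
    fun_prop
  -- The extra `1` in the exponent pays for the linear factor, through `S ≤ exp S`.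
  refine mem_fockSubmodule_of_norm_le hd (c := lam / 2 * ‖v‖) (C := lam / 2 * ‖w‖ + 1) fun z => ?_
  have h1 := norm_star_dotProduct_le v z
  have h2 := norm_coherentFun_le hlam w z
  set S := ∑ k, ‖z k‖ with hS
  have hS0 : 0 ≤ S := Finset.sum_nonneg fun k _ => norm_nonneg _
  have h3 : S ≤ Real.exp S := by linarith [Real.add_one_le_exp S]
  rw [coherentDerivFun, norm_mul, norm_mul, norm_div, Complex.norm_real,
    Real.norm_of_nonneg hlam.le, Complex.norm_two, add_mul, one_mul, Real.exp_add]
  calc lam / 2 * ‖star v ⬝ᵥ z‖ * ‖coherentFun lam w z‖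
      ≤ lam / 2 * (‖v‖ * Real.exp S) * Real.exp (lam / 2 * ‖w‖ * S) := by
        gcongr
        exact h1.trans (by gcongr)
    _ = _ := by ring

/-- The differential of `w ↦ e_w` at `w`. -/
def coherentDeriv [Fact (0 < lam)] (w : Fin n → ℂ) : (Fin n → ℂ) →L[ℝ] FockSpace n lam :=
  LinearMap.toContinuousLinearMap
    { toFun := fun v => ⟨coherentDerivFun lam w v, coherentDerivFun_mem w v⟩
      map_add' := fun u v => FockSpace.ext fun z => by
        change coherentDerivFun lam w (u + v) z
          = coherentDerivFun lam w u z + coherentDerivFun lam w v z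
        simp only [coherentDerivFun, star_add, add_dotProduct]
        ring
      map_smul' := fun r v => FockSpace.ext fun z => by
        change coherentDerivFun lam w (r • v) z = (r : ℂ) * coherentDerivFun lam w v z
        simp only [coherentDerivFun, star_smul, smul_dotProduct, star_trivial, Complex.real_smul]
        ring }

/-- The remainder is `e_w(z) (exp x - 1 - x)` with `x = λ v̄z / 2`, and `|exp x - 1 - x| ≤ |x|² exp
|x|`. The bound `‖v‖ ≤ 1` makes the exponent independent of `v`, and `S² ≤ 2 exp S` removes the
polynomial factor, so `v` enters only through `‖v‖²`. -/
theorem norm_coherent_add_sub_le [h : Fact (0 < lam)] (w v : Fin n → ℂ) (hv : ‖v‖ ≤ 1)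
    (z : Fin n → ℂ) :
    ‖(coherent n lam (w + v) - coherent n lam w - coherentDeriv w v : FockSpace n lam) z‖
      ≤ lam ^ 2 / 2 * ‖v‖ ^ 2 * Real.exp ((lam / 2 * ‖w‖ + lam / 2 + 1) * ∑ k, ‖z k‖) := by
  have hlam := h.out
  have h0 : (coherent n lam (w + v) - coherent n lam w - coherentDeriv w v : FockSpace n lam) z
      = coherentFun lam w z * (Complex.exp (lam / 2 * (star v ⬝ᵥ z)) - 1
        - lam / 2 * (star v ⬝ᵥ z)) := by
    change coherentFun lam (w + v) z - coherentFun lam w z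
      - lam / 2 * (star v ⬝ᵥ z) * coherentFun lam w z = _
    have : coherentFun lam (w + v) z
        = coherentFun lam w z * Complex.exp (lam / 2 * (star v ⬝ᵥ z)) := by
      rw [coherentFun, coherentFun, ← Complex.exp_add, star_add, add_dotProduct]
      congr 1
      ring
    rw [this]
    ring
  have h1 := norm_star_dotProduct_le v z
  have h2 := norm_coherentFun_le hlam w z
  set S := ∑ k, ‖z k‖ with hS
  have hS0 : 0 ≤ S := Finset.sum_nonneg fun k _ => norm_nonneg _
  have h3 : S ^ 2 ≤ 2 * Real.exp S := by linarith [Real.quadratic_le_exp_of_nonneg hS0]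
  set x : ℂ := lam / 2 * (star v ⬝ᵥ z) with hx
  have hxn : ‖x‖ ≤ lam / 2 * (‖v‖ * S) := by
    rw [hx, norm_mul, norm_div, Complex.norm_real, Real.norm_of_nonneg hlam.le, Complex.norm_two]
    gcongr
  have hxn' : ‖x‖ ≤ lam / 2 * S := hxn.trans (by
    gcongr
    exact mul_le_of_le_one_left hS0 hv)
  have h4 : ‖Complex.exp x - 1 - x‖ ≤ ‖x‖ ^ 2 * Real.exp ‖x‖ := by
    simpa [Finset.sum_range_succ, sub_sub] using Complex.norm_exp_sub_sum_le_norm_mul_exp x 2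
  rw [h0, norm_mul]
  calc ‖coherentFun lam w z‖ * ‖Complex.exp x - 1 - x‖
      ≤ Real.exp (lam / 2 * ‖w‖ * S) * ((lam / 2 * (‖v‖ * S)) ^ 2 * Real.exp (lam / 2 * S)) := by
        gcongr
        exact h4.trans (by gcongr)
    _ = (lam / 2 * ‖v‖) ^ 2 * S ^ 2 * (Real.exp (lam / 2 * ‖w‖ * S) * Real.exp (lam / 2 * S)) := by
        ring
    _ ≤ (lam / 2 * ‖v‖) ^ 2 * (2 * Real.exp S)
          * (Real.exp (lam / 2 * ‖w‖ * S) * Real.exp (lam / 2 * S)) := by gcongr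
    _ = _ := by
        rw [add_mul, add_mul, Real.exp_add, Real.exp_add, one_mul]
        ring

/-- The remainder is `O(‖v‖²)` in norm. The derivative is taken over `ℝ` because `e_w` is
antiholomorphic in `w`. -/
theorem hasFDerivAt_coherent [Fact (0 < lam)] (w : Fin n → ℂ) :
    HasFDerivAt (𝕜 := ℝ) (coherent n lam) (coherentDeriv w) w := by
  rw [hasFDerivAt_iff_isLittleO_nhds_zero]
  refine Asymptotics.IsBigO.trans_isLittleO ?_
    (Asymptotics.isLittleO_norm_pow_id (E' := Fin n → ℂ) one_lt_two)
  refine Asymptotics.IsBigO.of_bound (lam ^ 2 / 2 * ‖(memLp_exp_mul_sum_norm (n := n) (lam := lam)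
    (lam / 2 * ‖w‖ + lam / 2 + 1)).toLp _‖) ?_
  filter_upwards [Metric.closedBall_mem_nhds (0 : Fin n → ℂ) one_pos] with v hv
  have h := norm_le_of_norm_apply_le _ (norm_coherent_add_sub_le (lam := lam) w v (by simpa using hv))
  refine h.trans (le_of_eq ?_)
  rw [norm_pow, norm_norm]
  ring

/-- No further integral is computed: the known function `s ↦ ⟨e_z, e_{w + sv}⟩` is differentiated in
two ways. -/
theorem inner_coherent_coherentDeriv [Fact (0 < lam)] (z w v : Fin n → ℂ) :
    inner ℂ (coherent n lam z) (coherentDeriv w v)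
      = lam / 2 * (star v ⬝ᵥ z) * Complex.exp (lam / 2 * (star w ⬝ᵥ z)) := by
  have hline : HasDerivAt (fun s : ℝ => w + s • v) v 0 := by
    simpa using ((hasDerivAt_id (0 : ℝ)).smul_const v).const_add w
  have h1 : HasDerivAt (fun s : ℝ => coherent n lam (w + s • v)) (coherentDeriv w v) 0 :=
    HasFDerivAt.comp_hasDerivAt (l := coherent n lam) (l' := coherentDeriv w) (0 : ℝ)
      (by simpa using hasFDerivAt_coherent w) hline
  have h2 := ((innerSL ℂ (coherent n lam z)).restrictScalars ℝ).hasFDerivAt.comp_hasDerivAt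
    (0 : ℝ) h1
  have h3 : ∀ s : ℝ, (((innerSL ℂ (coherent n lam z)).restrictScalars ℝ) ∘
      fun s : ℝ => coherent n lam (w + s • v)) s
      = Complex.exp (lam / 2 * (star w ⬝ᵥ z) + s * (lam / 2 * (star v ⬝ᵥ z))) := fun s => by
    simp only [Function.comp_apply, ContinuousLinearMap.coe_restrictScalars', innerSL_apply_apply,
      inner_coherent, star_add, star_smul, star_trivial, add_dotProduct, smul_dotProduct,
      Complex.real_smul]
    congr 1
    ring
  have h4 := (((hasDerivAt_id (0 : ℝ)).ofReal_comp.mul_const (lam / 2 * (star v ⬝ᵥ z))).const_add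
    (lam / 2 * (star w ⬝ᵥ z) : ℂ)).cexp
  rw [funext h3] at h2
  have h5 := h2.unique h4
  simp only [ContinuousLinearMap.coe_restrictScalars', innerSL_apply_apply] at h5
  rw [h5]
  simp
  ring

end FockSpace

/-! ### The differential of the representation on coherent states -/

section differential
variable {m n : ℕ} {α : Fin n → Module.Dual ℝ (Fin m → ℝ)} {lam : ℝ}
  {χ : AddChar (Fin m → ℝ) Circle}

theorem star_dotProduct_rot_neg (t : Fin m → ℝ) (w z : Fin n → ℂ) :
    star w ⬝ᵥ rot α (-t) z = star (rot α t w) ⬝ᵥ z := by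
  refine Finset.sum_congr rfl fun k _ => ?_
  simp [rot, ← Complex.exp_conj]
  ring

/-- The factor `c` in `π(g) e_w = c e_{g · w}`. -/
def coherentFactor (lam : ℝ) (χ : AddChar (Fin m → ℝ) Circle) (g : Grp α) (w : Fin n → ℂ) : ℂ :=
  χ g.t * Complex.exp (Complex.I * lam * g.c - lam / 4 * (absSq g.z : ℂ)
    - lam / 2 * (star (rot α g.t w) ⬝ᵥ g.z))

/-- The exponent of `π(g) e_w` is affine in `z`: its linear part is `λ/2` times the conjugate of `g
• w`, and its constant part goes into the factor. -/
theorem piRep_coherent [Fact (0 < lam)] (g : Grp α) (w : Fin n → ℂ) :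
    piRep α lam χ g (FockSpace.coherent n lam w)
      = coherentFactor lam χ g w • FockSpace.coherent n lam (g • w) := by
  refine FockSpace.ext fun z => ?_
  change piFun lam χ g (FockSpace.coherentFun lam w) z
    = coherentFactor lam χ g w * FockSpace.coherentFun lam (g • w) z
  rw [piFun, coherentFactor, FockSpace.coherentFun, FockSpace.coherentFun,
    mul_assoc (χ g.t : ℂ), mul_assoc (χ g.t : ℂ), ← Complex.exp_add, ← Complex.exp_add,
    star_dotProduct_rot_neg, smul_def, star_add,
    add_dotProduct, sub_eq_add_neg z, dotProduct_add, dotProduct_neg]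
  congr 2
  ring

theorem exp_zero : exp α (0 : LieAlg m n) = 1 := by
  ext1
  · rfl
  · funext k; simp [exp]
  · simp [exp]

theorem hasDerivAt_exp_z (X : LieAlg m n) :
    HasDerivAt (fun s : ℝ => (exp α (s • X)).z) X.2.1 0 :=
  (hasDerivAt_exp X).snd.fst

theorem hasDerivAt_exp_c (X : LieAlg m n) :
    HasDerivAt (fun s : ℝ => (exp α (s • X)).c) X.2.2 0 :=
  (hasDerivAt_exp X).snd.snd

theorem hasDerivAt_rot_smul (t : Fin m → ℝ) (w : Fin n → ℂ) :
    HasDerivAt (fun s : ℝ => rot α (s • t) w) (fun k => (α k t : ℂ) * (Complex.I * w k)) 0 := by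
  have h : HasDerivAt (fun s : ℝ => s • t) t 0 := by
    simpa using (hasDerivAt_id (0 : ℝ)).smul_const t
  have h1 := HasFDerivAt.comp_hasDerivAt (l := fun t => rot α t w) (0 : ℝ)
    (by rw [zero_smul]; exact hasFDerivAt_rot w) h
  refine h1.congr_deriv ?_
  funext k
  simp

/-- The velocity at `w` of the flow of `X` on `ℂⁿ`. -/
def velocity (α : Fin n → Module.Dual ℝ (Fin m → ℝ)) (X : LieAlg m n) (w : Fin n → ℂ) :
    Fin n → ℂ :=
  (fun k => (α k X.1 : ℂ) * (Complex.I * w k)) + X.2.1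

theorem hasDerivAt_exp_smul (X : LieAlg m n) (w : Fin n → ℂ) :
    HasDerivAt (fun s : ℝ => exp α (s • X) • w) (velocity α X w) 0 :=
  (hasDerivAt_rot_smul X.1 w).add (hasDerivAt_exp_z X)

theorem hasDerivAt_coherentFactor (hχ : Continuous χ) (X : LieAlg m n) (w : Fin n → ℂ) :
    HasDerivAt (fun s : ℝ => coherentFactor lam χ (exp α (s • X)) w)
      (dchi χ X.1 + Complex.I * lam * X.2.2 - lam / 2 * (star w ⬝ᵥ X.2.1)) 0 := by
  have hz := hasDerivAt_pi.1 (hasDerivAt_exp_z (α := α) X)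
  have hr := hasDerivAt_pi.1 (hasDerivAt_rot_smul (α := α) X.1 w)
  -- `|z|²` vanishes to second order along a curve through `0`. Likewise in `h2` the rotation of `w`
  -- does not contribute, as it multiplies a vector that is `0` at `s = 0`.
  have h1 : HasDerivAt (fun s : ℝ => absSq (exp α (s • X)).z) 0 0 := by
    have h := HasDerivAt.fun_sum (u := Finset.univ) fun k _ => (hz k).norm_sq
    simpa [exp_zero] using! h
  have h2 : HasDerivAt (fun s : ℝ => star (rot α (s • X.1) w) ⬝ᵥ (exp α (s • X)).z)
      (star w ⬝ᵥ X.2.1) 0 := by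
    have h := HasDerivAt.fun_sum (u := Finset.univ) fun k _ => (hr k).star.mul (hz k)
    simpa [exp_zero, rot_zero, dotProduct] using! h
  have h3 := ((((hasDerivAt_exp_c (α := α) X).ofReal_comp.const_mul (Complex.I * lam)).sub
    (h1.ofReal_comp.const_mul (lam / 4 : ℂ))).sub (h2.const_mul (lam / 2 : ℂ))).cexp
  have h4 := (hasDerivAt_addChar_smul hχ X.1).mul h3
  refine (HasDerivAt.congr_deriv h4 ?_)
  simp [exp_zero, absSq]
  ring

theorem hasDerivAt_piRep_coherent [Fact (0 < lam)] (hχ : Continuous χ) (X : LieAlg m n)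
    (w : Fin n → ℂ) :
    HasDerivAt (fun s : ℝ => piRep α lam χ (exp α (s • X)) (FockSpace.coherent n lam w))
      (FockSpace.coherentDeriv w (velocity α X w)
        + (dchi χ X.1 + Complex.I * lam * X.2.2 - lam / 2 * (star w ⬝ᵥ X.2.1)) •
          FockSpace.coherent n lam w) 0 := by
  simp only [piRep_coherent]
  have h0 : exp α ((0 : ℝ) • X) • w = w := by
    rw [zero_smul, exp_zero, one_smul]
  have h1 : HasDerivAt (fun s : ℝ => FockSpace.coherent n lam (exp α (s • X) • w))
      (FockSpace.coherentDeriv w (velocity α X w)) 0 :=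
    HasFDerivAt.comp_hasDerivAt (l := FockSpace.coherent n lam) (l' := FockSpace.coherentDeriv w)
      (0 : ℝ) (by rw [h0]; exact FockSpace.hasFDerivAt_coherent w) (hasDerivAt_exp_smul X w)
  have h2 := (hasDerivAt_coherentFactor (α := α) (lam := lam) hχ X w).smul h1
  have h3 : coherentFactor lam χ (exp α ((0 : ℝ) • X)) w = 1 := by
    simp [coherentFactor, exp_zero, absSq]
  rw [h0, h3, one_smul] at h2
  exact h2

theorem coherent_mem_dpi_domain [Fact (0 < lam)] (hχ : Continuous χ) (X : LieAlg m n)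
    (w : Fin n → ℂ) : FockSpace.coherent n lam w ∈ (dpi α lam χ X).domain :=
  (hasDerivAt_piRep_coherent hχ X w).differentiableAt

theorem kernel_dpi [Fact (0 < lam)] (hχ : Continuous χ) (X : LieAlg m n) (z w : Fin n → ℂ) :
    kernel (dpi α lam χ X) z w = (dchi χ X.1 + Complex.I * lam * X.2.2
      - lam / 2 * (star w ⬝ᵥ X.2.1) + lam / 2 * (star (velocity α X w) ⬝ᵥ z))
        * Complex.exp (lam / 2 * (star w ⬝ᵥ z)) := by
  rw [kernel, dif_pos (coherent_mem_dpi_domain hχ X w)]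
  have h : dpi α lam χ X ⟨FockSpace.coherent n lam w, coherent_mem_dpi_domain hχ X w⟩ = _ :=
    (hasDerivAt_piRep_coherent hχ X w).deriv
  rw [h, inner_add_right, inner_smul_right, FockSpace.inner_coherent,
    FockSpace.inner_coherent_coherentDeriv]
  ring

/-! ### The Weyl symbol of the differential -/

/-- The Weyl integrand of `dπ(X)` is a Gaussian times a sum of quadratic polynomials, each in one
of the variables. -/
theorem weylIntegrand_dpi [Fact (0 < lam)] (hχ : Continuous χ) (X : LieAlg m n)
    (z w : Fin n → ℂ) :
    weylIntegrand (dpi α lam χ X) z w =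
      (dchi χ X.1 + Complex.I * lam * X.2.2) * Complex.exp (-lam * (absSq w : ℂ))
      + ∑ k, ((-lam / 2 * star (z k) * X.2.1 k + lam / 2 * star (X.2.1 k) * z k
            - Complex.I * α k X.1 * lam / 2 * (‖z k‖ : ℂ) ^ 2)
          + (lam / 2 * star (X.2.1 k) - Complex.I * α k X.1 * lam / 2 * star (z k)) * w k
          + (lam / 2 * X.2.1 k + Complex.I * α k X.1 * lam / 2 * z k) * star (w k)
          + (Complex.I * α k X.1 * lam / 2) * (‖w k‖ : ℂ) ^ 2)
        * Complex.exp (-lam * (absSq w : ℂ)) := by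
  -- Of the exponent `(z̄ - w̄)(z + w)` of the kernel, the Weyl weight cancels everything but
  -- `-w̄w`, which it doubles.
  have h1 : (lam / 2 * (star (z - w) ⬝ᵥ (z + w)) : ℂ) + lam / 2 * (-(z ⬝ᵥ star z) - w ⬝ᵥ star w
      + z ⬝ᵥ star w - star z ⬝ᵥ w) = -lam * (absSq w : ℂ) := by
    have h2 : (absSq w : ℂ) = w ⬝ᵥ star w := by
      simp [absSq, dotProduct, Complex.mul_conj, Complex.normSq_eq_norm_sq]
    rw [h2, star_sub, sub_dotProduct, dotProduct_add, dotProduct_add, dotProduct_comm (star z) z,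
      dotProduct_comm (star w) z, dotProduct_comm (star w) w]
    ring
  rw [weylIntegrand, kernel_dpi hχ, mul_assoc, ← Complex.exp_add, h1, ← Finset.sum_mul, ← add_mul]
  congr 1
  rw [sub_add, sub_eq_add_neg, add_right_inj, dotProduct, dotProduct, Finset.mul_sum,
    Finset.mul_sum, ← Finset.sum_sub_distrib, ← Finset.sum_neg_distrib]
  refine Finset.sum_congr rfl fun k _ => ?_
  have h3 : ∀ v : ℂ, (‖v‖ : ℂ) ^ 2 = v * star v := fun v => by
    rw [← Complex.ofReal_pow, ← Complex.normSq_eq_norm_sq, Complex.star_def, Complex.mul_conj]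
  simp only [h3, velocity]
  simp
  ring

theorem integrable_weylIntegrand_dpi [h : Fact (0 < lam)] (hχ : Continuous χ) (X : LieAlg m n)
    (z : Fin n → ℂ) : Integrable (weylIntegrand (dpi α lam χ X) z) (mu n lam) := by
  rw [mu, integrable_smul_measure (by simpa using FockSpace.const_pos) ENNReal.ofReal_ne_top,
    funext (weylIntegrand_dpi hχ X z)]
  exact integrable_sum_quadratic_mul_gaussian h.out _ _ _ _ _

/-- Of the coefficients only the constant ones and those of `|w_k|²` survive; the latter, `iα_k
λ/2`, are divided by `b = λ` and become `iα_k / 2`. -/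
theorem W0_dpi [h : Fact (0 < lam)] (hχ : Continuous χ) (X : LieAlg m n) (z : Fin n → ℂ) :
    W0 (dpi α lam χ X) z = Complex.I * (momentMap α lam χ z X : ℂ) := by
  have hl : (lam : ℂ) ≠ 0 := by exact_mod_cast h.out.ne'
  have hpi : (Real.pi : ℂ) ≠ 0 := by exact_mod_cast Real.pi_ne_zero
  have hω : (omegaR z X.2.1 : ℂ)
      = ∑ k, Complex.I / 2 * (z k * star (X.2.1 k) - X.2.1 k * star (z k)) := by
    rw [← omega_star_eq, omega, dotProduct, dotProduct, ← Finset.sum_sub_distrib, Finset.mul_sum]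
    rfl
  rw [W0, funext (weylIntegrand_dpi hχ X z), mu, integral_smul_measure,
    ENNReal.toReal_ofReal FockSpace.const_pos.le, Complex.real_smul,
    integral_sum_quadratic_mul_gaussian h.out, ← mul_assoc, ← mul_assoc]
  -- The prefactor `2ⁿ`, the density of `mu` and the Gaussian mass `(π/λ)ⁿ` multiply to `1`.
  rw [Complex.ofReal_pow, ← mul_pow, ← mul_pow,
    show (2 * ((lam / (2 * Real.pi) : ℝ) : ℂ) * (Real.pi / lam)) = 1 by push_cast; field_simp,
    one_pow, one_mul, momentMap_apply]
  push_cast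
  rw [negIdchi_eq hχ, hω]
  have key : ∑ k, (-lam / 2 * star (z k) * X.2.1 k + lam / 2 * star (X.2.1 k) * z k
        - Complex.I * α k X.1 * lam / 2 * (‖z k‖ : ℂ) ^ 2
        + Complex.I * α k X.1 * lam / 2 / lam)
      = Complex.I * (1 / 2 * ∑ k, (1 - lam * (‖z k‖ : ℂ) ^ 2) * (α k X.1 : ℂ)
        - lam * ∑ k, Complex.I / 2 * (z k * star (X.2.1 k) - X.2.1 k * star (z k))) := by
    simp only [Finset.mul_sum, ← Finset.sum_sub_distrib]
    refine Finset.sum_congr rfl fun k _ => ?_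
    field_simp
    linear_combination (-lam * (X.2.1 k * star (z k) - z k * star (X.2.1 k)) : ℂ) * Complex.I_sq
  rw [key]
  linear_combination dchi χ X.1 * Complex.I_sq

end differential

end Diamond

theorem mainTheorem6 {m n : ℕ} (α : Fin n → Module.Dual ℝ (Fin m → ℝ))
    (lam : ℝ) [Fact (0 < lam)] (χ : AddChar (Fin m → ℝ) Circle) (hχ : Continuous χ) :
    -- `χ` is differentiable at `0` and `-i dχ` is real-valued
    (DifferentiableAt ℝ (fun t => (χ t : ℂ)) 0 ∧
      ∀ t, (Diamond.negIdchi χ t : ℂ) = -Complex.I * Diamond.dchi χ t) ∧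
    -- the kernel of `dπ(X)` is defined, and the integral that defines `W₀(dπ(X))` converges
    (∀ X w, Diamond.FockSpace.coherent n lam w ∈ (Diamond.dpi α lam χ X).domain) ∧
    (∀ X z, MeasureTheory.Integrable (Diamond.weylIntegrand (Diamond.dpi α lam χ X) z)
      (Diamond.mu n lam)) ∧
    ∃ ψ : (Fin n → ℂ) → Module.Dual ℝ (Diamond.LieAlg m n),
      (∀ X z, Diamond.W0 (Diamond.dpi α lam χ X) z = Complex.I * (ψ z X : ℂ)) ∧
      (∀ (g : Diamond.Grp α) (z : Fin n → ℂ), ψ (g • z) = Diamond.coAd g (ψ z)) ∧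
      (∀ z, ψ z = Diamond.dualElt
        (Diamond.negIdchi χ + (1 / 2 : ℝ) • ∑ k, (1 - lam * ‖z k‖ ^ 2) • α k) (-(lam • z)) lam) ∧
      Set.BijOn ψ Set.univ (Diamond.coadjointOrbit α
        (Diamond.dualElt (Diamond.negIdchi χ + (1 / 2 : ℝ) • ∑ k, α k) 0 lam)) :=
  ⟨⟨Diamond.differentiable_addChar hχ 0, Diamond.negIdchi_eq hχ⟩,
    Diamond.coherent_mem_dpi_domain hχ, Diamond.integrable_weylIntegrand_dpi hχ,
    Diamond.momentMap α lam χ, Diamond.W0_dpi hχ, Diamond.momentMap_smul lam χ, fun _ => rfl,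
    Diamond.momentMap_bijOn Fact.out χ⟩
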